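/- Let $\mathcal H$ be a separable infinite-dimensional real Hilbert space, let $B$ be a strictly positive bounded operator on $\mathcal H$, and let $\mu=\mu_B$ be a centered Gaussian measure on $\mathcal H$ with covariance operator $B$, i.e. a Borel probability measure with $\int e^{i\langle x,y\rangle}\,d\mu(x)=e^{-\frac12\langle By,y\rangle}$ for all $y\in\mathcal H$. Let $\mathcal H_0=B^{1/2}\mathcal H$, a Hilbert space with the inner product $\langle x,y\rangle_0=\langle B^{-1/2}x,B^{-1/2}y\rangle$ and norm $\|\cdot\|_0$. Let $h\mapsto l_h=\langle B^{-1}h,\cdot\rangle$ be the isometric embedding of $\mathcal H_0$ into $L^2(\mathcal H,\mu)$ that extends the map $Bv\mapsto\langle v,\cdot\rangle$ by continuity, and put $\exp_h(x)=e^{l_h(x)-\frac12\|h\|_0^2}$ for $h\in\mathcal H_0$. Let $\mathrm{Aff}(\mathcal H_0)$ be the set of pairs $A=(f,V)$ with $f\in\mathcal H_0$ and $V$ an orthogonal operator of $\mathcal H_0$, and put $\alpha_t(f,V)=(tf,V)$. The Weyl operator $W_{(f,V)}$ is the unitary operator of $L^2(\mathcal H,\mu)$ with $$W_{(f,V)}\exp_h=e^{-\langle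 f,Vh\rangle_0-\frac12\|f\|_0^2}\exp_{f+Vh},\qquad h\in\mathcal H_0.$$ The nonsingular Gaussian transformation $T_A$ generated by $A$ is the invertible $\mu$-nonsingular transformation of $(\mathcal H,\mu)$ (unique modulo $\mu$-null sets) such that $U_{T_A}=W_{\alpha_{1/2}(A)}$, where $U_Tg=g\circ T^{-1}\cdot\sqrt{\frac{d(\mu\circ T^{-1})}{d\mu}}$. An invertible nonsingular transformation $T$ is conservative if every measurable set $W$ for which the sets $T^nW$, $n\in\mathbb Z$, are pairwise disjoint (a wandering set) is null; it is totally dissipative if there is a wandering set $W$ with $\mu\bigl(\mathcal H\setminus\bigsqcup_{n\in\mathbb Z}T^nW\bigr)=0$. **Proposition.** Let $A=(f,V)\in\mathrm{Aff}(\mathcal H_0)$ be such that $V$ has no non-zero invariant vectors. Then there is $t_{\mathrm{diss}}(A)\in[0,+\infty]$ such that for every real $t>0$ the transformation $T_{\alpha_t(A)}$ exists, and it is conservative if $t<t_{\mathrm{diss}}(A)$ and totally dissipative if $t>t_{\mathrm{diss}}(A)$. -/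

import Mathlib

open MeasureTheory ProbabilityTheory
open scoped ENNReal RealInnerProductSpace

noncomputable section

namespace NonsingularGaussian

/-! ### Covariance operators and the Cameron-Martin space -/

/-- `B` is a strictly positive bounded operator on `H` and `S = B^{1/2}`, i.e. `S` is the (unique)
positive operator with `S ∘ S = B`. -/
structure IsSqrtOf {H : Type*} [NormedAddCommGroup H] [InnerProductSpace ℝ H]
    (S B : H →L[ℝ] H) : Prop where
  /-- `B` is strictly positive. -/
  strictlyPos : ∀ x : H, x ≠ 0 → 0 < ⟪B x, x⟫
  /-- The square root is positive (in particular symmetric). -/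
  sqrt_pos : S.IsPositive
  /-- The square of `S` is `B`. -/
  sqrt_sq : S ∘L S = B

section CameronMartin

variable {H : Type*} [NormedAddCommGroup H] [InnerProductSpace ℝ H] {S B : H →L[ℝ] H}

theorem IsSqrtOf.injective (hS : IsSqrtOf S B) :
    Function.Injective (S : H →ₗ[ℝ] H) := by
  rw [injective_iff_map_eq_zero]
  intro x hx
  by_contra hne
  have hx' : S x = 0 := hx
  have h := hS.strictlyPos x hne
  rw [← hS.sqrt_sq, ContinuousLinearMap.comp_apply, hx', map_zero, inner_zero_left] at h
  exact lt_irrefl _ h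

/-- The space `H₀ = B^{1/2} H ⊆ H`, which carries its own inner product (below). -/
def CameronMartin (_hS : IsSqrtOf S B) : Type _ := LinearMap.range (S : H →ₗ[ℝ] H)

namespace CameronMartin

variable (hS : IsSqrtOf S B)

instance : AddCommGroup (CameronMartin hS) :=
  inferInstanceAs (AddCommGroup (LinearMap.range (S : H →ₗ[ℝ] H)))

instance : Module ℝ (CameronMartin hS) :=
  inferInstanceAs (Module ℝ (LinearMap.range (S : H →ₗ[ℝ] H)))

/-- The inclusion `H₀ ⊆ H`. -/
def incl : CameronMartin hS →ₗ[ℝ] H := (LinearMap.range (S : H →ₗ[ℝ] H)).subtype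

/-- The linear bijection `B^{1/2} : H → H₀`. -/
def sqrtEquiv : H ≃ₗ[ℝ] CameronMartin hS :=
  LinearEquiv.ofInjective (S : H →ₗ[ℝ] H) hS.injective

theorem incl_sqrtEquiv (x : H) : incl hS (sqrtEquiv hS x) = S x := rfl

/-- The norm `‖x‖₀ = ‖B^{-1/2} x‖` on `H₀`. -/
instance : NormedAddCommGroup (CameronMartin hS) :=
  NormedAddCommGroup.induced (CameronMartin hS) H (sqrtEquiv hS).symm.toLinearMap
    (sqrtEquiv hS).symm.injective

/-- The inner product `⟪x, y⟫₀ = ⟪B^{-1/2} x, B^{-1/2} y⟫` on `H₀`. -/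
instance : InnerProductSpace ℝ (CameronMartin hS) where
  norm_smul_le c x := by
    change ‖(sqrtEquiv hS).symm (c • x)‖ ≤ ‖c‖ * ‖(sqrtEquiv hS).symm x‖
    rw [map_smul, norm_smul]
  inner x y := ⟪(sqrtEquiv hS).symm x, (sqrtEquiv hS).symm y⟫
  norm_sq_eq_re_inner x := norm_sq_eq_re_inner (𝕜 := ℝ) ((sqrtEquiv hS).symm x)
  conj_inner_symm x y := inner_conj_symm ((sqrtEquiv hS).symm x) ((sqrtEquiv hS).symm y)
  add_left x y z := by simp only [map_add, inner_add_left]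
  smul_left x y r := by simp only [map_smul, inner_smul_left]

theorem norm_def (x : CameronMartin hS) : ‖x‖ = ‖(sqrtEquiv hS).symm x‖ := rfl

theorem inner_def (x y : CameronMartin hS) :
    ⟪x, y⟫ = ⟪(sqrtEquiv hS).symm x, (sqrtEquiv hS).symm y⟫ := rfl

/-- The operator `B`, seen as a map `H → H₀`; its range is the dense subspace `B H` of `H₀`. -/
def covToCM : H →ₗ[ℝ] CameronMartin hS := (sqrtEquiv hS).toLinearMap ∘ₗ (S : H →ₗ[ℝ] H)

theorem incl_covToCM (v : H) : incl hS (covToCM hS v) = B v := by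
  have h : incl hS (covToCM hS v) = (S ∘L S) v := rfl
  rw [h, hS.sqrt_sq]

end CameronMartin

/-- `μ` is the centered Gaussian measure `μ_B` with covariance operator `B`, i.e. its
characteristic functional is `y ↦ exp (-⟪B y, y⟫ / 2)`. -/
def IsCenteredGaussian [MeasurableSpace H] (μ : Measure H) (B : H →L[ℝ] H) : Prop :=
  ∀ y : H, charFun μ y = Complex.exp (-((⟪B y, y⟫ / 2 : ℝ) : ℂ))

end CameronMartin

/-! ### Affine isometries -/

/-- `Aff(K) = K ⋊ O(K)`: pairs `A = (f, V)` of a vector `f` of `K` and an orthogonal operator `V`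
of `K`; such a pair acts on `K` by `h ↦ f + V h`. -/
structure Aff (K : Type*) [NormedAddCommGroup K] [InnerProductSpace ℝ K] where
  /-- The translation part `f`. -/
  f : K
  /-- The orthogonal part `V`. -/
  V : K ≃ₗᵢ[ℝ] K

/-- The map `α_t (f, V) = (t f, V)`. -/
def Aff.dilate {K : Type*} [NormedAddCommGroup K] [InnerProductSpace ℝ K]
    (t : ℝ) (A : Aff K) : Aff K := ⟨t • A.f, A.V⟩

/-! ### Exponential vectors, Koopman operators, nonsingular Gaussian transformations -/

section Transformations

variable {H : Type*} [NormedAddCommGroup H] [InnerProductSpace ℝ H]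
  [MeasurableSpace H] [BorelSpace H] {S B : H →L[ℝ] H}

/-- The isometric embedding `h ↦ l_h = ⟪B⁻¹ h, ·⟫` of `H₀` into `L²(H, μ)`: the extension by
continuity of the map `B v ↦ ⟪v, ·⟫`, which is defined on the dense subspace `B H` of `H₀`. -/
def ell (μ : Measure H) (hS : IsSqrtOf S B) : CameronMartin hS →L[ℝ] Lp ℝ 2 μ :=
  LinearMap.extendOfNorm
    ((StrongDual.toLp μ 2 : StrongDual ℝ H →L[ℝ] Lp ℝ 2 μ).toLinearMap ∘ₗ
      (innerSL ℝ : H →L[ℝ] StrongDual ℝ H).toLinearMap)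
    (CameronMartin.covToCM hS)

/-- The exponential vector `exp_h`, as the function `exp (⟪B⁻¹ h, ·⟫ - ‖h‖₀² / 2)` on `H`. -/
def expVec (μ : Measure H) {hS : IsSqrtOf S B} (h : CameronMartin hS) (x : H) : ℝ :=
  Real.exp (ell μ hS h x - ‖h‖ ^ 2 / 2)

/-- The image of the exponential vector `exp_h` under the Weyl unitary operator `W_A`,
`A = (f, V)`: `W_A exp_h = exp (-⟪f, V h⟫₀ - ‖f‖₀² / 2) • exp_{f + V h}`. As the exponential
vectors are total in `L²(H, μ)`, these values determine `W_A`. -/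
def weylExp (μ : Measure H) {hS : IsSqrtOf S B} (A : Aff (CameronMartin hS))
    (h : CameronMartin hS) (x : H) : ℝ :=
  Real.exp (-⟪A.f, A.V h⟫ - ‖A.f‖ ^ 2 / 2) * expVec μ (A.f + A.V h) x

/-- The Koopman operator `U_T g = (g ∘ T⁻¹) · √(d(μ ∘ T⁻¹)/dμ)` of an invertible
transformation `T`. -/
def koopman (μ : Measure H) (T : H ≃ᵐ H) (g : H → ℝ) (x : H) : ℝ :=
  g (T.symm x) * √((μ.map T).rnDeriv μ x).toReal

/-- `T` is the nonsingular Gaussian transformation `T_A` (more precisely, an everywhere invertible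
representative of that class of transformations modulo `μ`-null sets): an invertible
`μ`-nonsingular transformation such that `U_T = W_{α_{1/2} A}`, an equality of bounded operators
that is expressed on the total family of the exponential vectors. -/
structure IsGaussianTransformation (μ : Measure H) {hS : IsSqrtOf S B}
    (A : Aff (CameronMartin hS)) (T : H ≃ᵐ H) : Prop where
  quasi : Measure.QuasiMeasurePreserving T μ μ
  quasi_symm : Measure.QuasiMeasurePreserving T.symm μ μ
  koopman_eq : ∀ h : CameronMartin hS,
    koopman μ T (expVec μ h) =ᵐ[μ] weylExp μ (A.dilate (1 / 2)) h

end Transformations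

/-! ### Wandering sets -/

section Hopf

variable {X : Type*} [MeasurableSpace X]

/-- A measurable set `W` is wandering for `T` if the sets `T ^ n W`, `n ∈ ℤ`, are pairwise
disjoint. -/
def IsWandering (T : X ≃ᵐ X) (W : Set X) : Prop :=
  MeasurableSet W ∧ Pairwise fun m n : ℤ =>
    Disjoint (((T.toEquiv : Equiv.Perm X) ^ m) '' W) (((T.toEquiv : Equiv.Perm X) ^ n) '' W)

/-- `T` is conservative: every wandering set is null. -/
def IsConservative (μ : Measure X) (T : X ≃ᵐ X) : Prop :=
  ∀ W : Set X, IsWandering T W → μ W = 0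

/-- `T` is totally dissipative: the whole space is, up to a null set, the union of the (pairwise
disjoint) translates `T ^ n W`, `n ∈ ℤ`, of a wandering set `W`. -/
def IsTotallyDissipative (μ : Measure X) (T : X ≃ᵐ X) : Prop :=
  ∃ W : Set X, IsWandering T W ∧ μ (⋃ n : ℤ, ((T.toEquiv : Equiv.Perm X) ^ n) '' W)ᶜ = 0

end Hopf

end NonsingularGaussian

end

open Filter Topology

set_option linter.unusedSectionVars false

noncomputable section

namespace NonsingularGaussian

/-! ### The Gaussian Hilbert space and the Cameron-Martin formula -/

section Ell

variable {H : Type*} [NormedAddCommGroup H] [InnerProductSpace ℝ H] {S B : H →L[ℝ] H}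

namespace CameronMartin

variable (hS : IsSqrtOf S B)

/-! Write `A.orbit n` for the orbit of 0 under h ↦ f + V h. `T_A` carries the density exp_u to
exp_{f + V u}, so `T_A ^ n` has density exp_{A.orbit n} (`map_zpow`). By Hopf's criterion the
behaviour of `T_A` is decided by the series Σ exp_{A.orbit n}(x): divergence a.e. gives
conservativity, convergence a.e. gives total dissipativity.

Zero-one law: translation by h ∈ H₀ multiplies the n-th term by e^{⟪A.orbit n, h⟫}. For h = g - V⁻¹
g this pairing is bounded in n (`abs_inner_orbit_le`), and such h are dense because V fixes no
non-zero vector. The convergence set is thus invariant under a dense set of translations, hence null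
or conull.

Monotonicity: for t < s put r² = s² - t². Under the measure-preserving rotation (x, y) ↦ (t x + r y)
/ s, exp_{s u} becomes exp_{t u}(x) exp_{r u}(y), and the second factor has integral 1. So
convergence at t forces convergence at s (`ae_mem_summableSet_of_lt`), and the threshold is the
infimum of the convergent parameters.

Existence: `T_A` is the extension of V⁻¹ to a measure-preserving map of H, followed by translation
by f; the Cameron-Martin formula gives its density. -/

theorem norm_covToCM (v : H) : ‖covToCM hS v‖ = ‖S v‖ := by
  rw [norm_def]
  simp [covToCM]

theorem inner_covToCM (v : H) (h : CameronMartin hS) : ⟪covToCM hS v, h⟫ = ⟪v, incl hS h⟫ := by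
  obtain ⟨w, rfl⟩ := (sqrtEquiv hS).surjective h
  rw [inner_def, incl_sqrtEquiv]
  simp only [covToCM, LinearMap.comp_apply, LinearEquiv.coe_coe, LinearEquiv.symm_apply_apply]
  exact hS.sqrt_pos.isSymmetric v w

theorem norm_sq_covToCM (v : H) : ‖covToCM hS v‖ ^ 2 = ⟪B v, v⟫ := by
  rw [← real_inner_self_eq_norm_sq, inner_covToCM, incl_covToCM, real_inner_comm]

/-- `B^{1/2} : H → H₀` is an isometric isomorphism. -/
def sqrtIsometry : H ≃ₗᵢ[ℝ] CameronMartin hS where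
  toLinearEquiv := sqrtEquiv hS
  norm_map' x := by rw [norm_def, LinearEquiv.symm_apply_apply]

theorem sqrtIsometry_apply (x : H) : sqrtIsometry hS x = sqrtEquiv hS x := rfl

theorem complete [CompleteSpace H] : CompleteSpace (CameronMartin hS) :=
  (sqrtIsometry hS).toIsometryEquiv.completeSpace_iff.mp inferInstance

theorem denseRange_covToCM [CompleteSpace H] : DenseRange (covToCM hS) := by
  have := complete hS
  have h : (LinearMap.range (covToCM hS))ᗮ = ⊥ := by
    rw [Submodule.eq_bot_iff]
    intro x hx
    obtain ⟨w, rfl⟩ := (sqrtIsometry hS).surjective x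
    have h1 := hx _ (LinearMap.mem_range_self _ w)
    rw [inner_covToCM, sqrtIsometry_apply, incl_sqrtEquiv] at h1
    -- Testing against `B (S w)` yields ‖S w‖² = 0.
    have h2 := hx _ (LinearMap.mem_range_self _ (S w))
    rw [inner_covToCM, sqrtIsometry_apply, incl_sqrtEquiv, real_inner_self_eq_norm_sq] at h2
    have h3 : S w = 0 := by simpa using h2
    have h4 : w = 0 := hS.injective (by simpa using h3)
    simp [h4]
  rw [← Submodule.topologicalClosure_eq_top_iff] at h
  have := Submodule.dense_iff_topologicalClosure_eq_top.mpr h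
  simpa only [DenseRange, LinearMap.coe_range] using this

end CameronMartin

open CameronMartin

variable [CompleteSpace H] [TopologicalSpace.SeparableSpace H] [MeasurableSpace H] [BorelSpace H]
  {μ : Measure H} [IsProbabilityMeasure μ]

theorem IsCenteredGaussian.map_inner (hS : IsSqrtOf S B) (hμ : IsCenteredGaussian μ B) (v : H) :
    μ.map (innerSL ℝ v) = gaussianReal 0 (‖S v‖₊ ^ 2) := by
  apply Measure.ext_of_charFun
  ext s
  rw [charFun_gaussianReal, charFun_map_eq_charFunDual_smul, charFunDual_apply]
  have h := hμ (s • v)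
  rw [charFun_apply] at h
  have h2 := norm_sq_covToCM hS v
  rw [norm_covToCM] at h2
  simp only [smul_apply, innerSL_apply_apply]
  simp only [inner_smul_right, map_smul, inner_smul_left, ← h2] at h
  simp_rw [smul_eq_mul, real_inner_comm _ v]
  rw [h]
  push_cast
  congr 1
  simp
  ring

theorem IsCenteredGaussian.isGaussian (hS : IsSqrtOf S B) (hμ : IsCenteredGaussian μ B) :
    IsGaussian μ := by
  apply isGaussian_of_map_eq_gaussianReal
  intro L
  obtain ⟨v, rfl⟩ := (InnerProductSpace.toDual ℝ H).surjective L
  exact ⟨_, _, hμ.map_inner hS v⟩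

theorem IsCenteredGaussian.memLp_id (hS : IsSqrtOf S B) (hμ : IsCenteredGaussian μ B) :
    MemLp id 2 μ := by
  have := hμ.isGaussian hS
  have : SecondCountableTopology H := UniformSpace.secondCountable_of_separable H
  exact IsGaussian.memLp_two_id

theorem IsCenteredGaussian.norm_toLp (hS : IsSqrtOf S B) (hμ : IsCenteredGaussian μ B) (v : H) :
    ‖(StrongDual.toLp μ 2 : StrongDual ℝ H →L[ℝ] Lp ℝ 2 μ) (innerSL ℝ v)‖ = ‖covToCM hS v‖ := by
  have hm := hμ.memLp_id hS
  have hg := hμ.isGaussian hS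
  have h0 : MemLp (innerSL ℝ v) 2 μ := hm.continuousLinearMap_comp (innerSL ℝ v)
  rw [norm_covToCM, StrongDual.toLp_apply hm]
  refine (sq_eq_sq₀ (norm_nonneg _) (norm_nonneg _)).mp ?_
  rw [Lp.norm_toLp, h0.eLpNorm_eq_integral_rpow_norm (by norm_num) (by norm_num)]
  have hmap := hμ.map_inner hS v
  have h1 : ∫ x, ‖(innerSL ℝ v) x‖ ^ 2 ∂μ = ‖S v‖ ^ 2 := by
    have h2 : ∫ y, y ^ 2 ∂(gaussianReal 0 (‖S v‖₊ ^ 2)) = ‖S v‖ ^ 2 := by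
      have := variance_id_gaussianReal (μ := 0) (v := ‖S v‖₊ ^ 2)
      rw [variance_eq_integral (by fun_prop)] at this
      simpa using this
    rw [← h2, ← hmap, integral_map (by fun_prop) (by fun_prop)]
    simp
  have h3 : ∫ x, ‖(innerSL ℝ v) x‖ ^ (2 : ℝ≥0∞).toReal ∂μ = ‖S v‖ ^ 2 := by
    rw [← h1]
    simp
  rw [h3, ENNReal.toReal_ofReal (by positivity)]
  simp only [ENNReal.toReal_ofNat]
  rw [← Real.rpow_natCast, ← Real.rpow_mul (by positivity)]
  norm_num

/-- The isometry `norm_toLp` supplies the norm bound, with constant 1, that the extension by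
continuity needs besides density. -/
theorem IsCenteredGaussian.ell_covToCM (hS : IsSqrtOf S B) (hμ : IsCenteredGaussian μ B) (v : H) :
    ell μ hS (covToCM hS v) =ᵐ[μ] fun x => ⟪v, x⟫ := by
  have h : ell μ hS (covToCM hS v)
      = (StrongDual.toLp μ 2 : StrongDual ℝ H →L[ℝ] Lp ℝ 2 μ) (innerSL ℝ v) := by
    refine LinearMap.extendOfNorm_eq (denseRange_covToCM hS) ⟨1, fun x => ?_⟩ v
    rw [one_mul]
    exact (hμ.norm_toLp hS x).le
  rw [h, StrongDual.toLp_apply (hμ.memLp_id hS)]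
  exact MemLp.coeFn_toLp _

/-! ### Gaussian laws and limits of the functions l_h -/

variable {hS : IsSqrtOf S B}

theorem measurable_ell (h : CameronMartin hS) : Measurable (ell μ hS h) :=
  (Lp.stronglyMeasurable _).measurable

theorem measurable_expVec (h : CameronMartin hS) : Measurable (expVec μ h) :=
  Real.measurable_exp.comp ((measurable_ell h).sub_const _)

theorem expVec_pos (h : CameronMartin hS) (x : H) : 0 < expVec μ h x := Real.exp_pos _

theorem ell_add (u w : CameronMartin hS) :
    ell μ hS (u + w) =ᵐ[μ] fun x => ell μ hS u x + ell μ hS w x := by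
  rw [map_add]
  exact Lp.coeFn_add _ _

theorem ell_smul (c : ℝ) (u : CameronMartin hS) :
    ell μ hS (c • u) =ᵐ[μ] fun x => c * ell μ hS u x := by
  rw [map_smul]
  exact Lp.coeFn_smul _ _

/-- Convergence in L² gives a.e. convergence of a subsequence. This transfers pointwise identities
from B H, where l is an honest inner product, to all of H₀. -/
theorem exists_subseq_ell_tendsto {u : ℕ → CameronMartin hS} {w : CameronMartin hS}
    (hu : Tendsto u atTop (𝓝 w)) :
    ∃ ns : ℕ → ℕ, StrictMono ns ∧
      ∀ᵐ x ∂μ, Tendsto (fun n => ell μ hS (u (ns n)) x) atTop (𝓝 (ell μ hS w x)) :=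
  (tendstoInMeasure_of_tendsto_Lp
    (((ell μ hS).continuous.tendsto w).comp hu)).exists_seq_tendsto_ae

theorem exists_seq_covToCM_tendsto (w : CameronMartin hS) :
    ∃ v : ℕ → H, Tendsto (fun n => covToCM hS (v n)) atTop (𝓝 w) := by
  obtain ⟨u, hu, hlim⟩ := mem_closure_iff_seq_limit.mp (denseRange_covToCM hS w)
  choose v hv using hu
  exact ⟨v, by simpa [hv] using hlim⟩

/-- Allowing ν ≪ μ is what the zero-one law needs, where ν is μ conditioned on an invariant set. -/
theorem continuous_integral_cexp_ell {ν : Measure H} [IsFiniteMeasure ν] (hν : ν ≪ μ) :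
    Continuous fun h : CameronMartin hS => ∫ x, Complex.exp (ell μ hS h x * Complex.I) ∂ν := by
  rw [continuous_iff_seqContinuous]
  intro u w hu
  refine tendsto_of_subseq_tendsto fun ns hns => ?_
  obtain ⟨ms, -, hms⟩ := exists_subseq_ell_tendsto (μ := μ) (hu.comp hns)
  refine ⟨ms, ?_⟩
  refine tendsto_integral_of_dominated_convergence (fun _ => 1) (fun n => ?_) (integrable_const _)
    (fun n => ?_) ?_
  · have := measurable_ell (μ := μ) (u (ns (ms n)))
    exact Measurable.aestronglyMeasurable (by fun_prop)
  · exact ae_of_all _ fun x => (Complex.norm_exp_ofReal_mul_I _).le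
  · filter_upwards [hν hms] with x hx
    exact ((Complex.continuous_exp.comp
      (Complex.continuous_ofReal.mul continuous_const)).tendsto _).comp hx

theorem integral_cexp_ell_covToCM (hμ : IsCenteredGaussian μ B) {ν : Measure H} (hν : ν ≪ μ)
    (v : H) : ∫ x, Complex.exp (ell μ hS (covToCM hS v) x * Complex.I) ∂ν = charFun ν v := by
  rw [charFun_apply]
  refine integral_congr_ae ?_
  filter_upwards [hν (hμ.ell_covToCM hS v)] with x hx
  rw [hx, real_inner_comm]

theorem integral_cexp_ell (hμ : IsCenteredGaussian μ B) (h : CameronMartin hS) :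
    ∫ x, Complex.exp (ell μ hS h x * Complex.I) ∂μ = Complex.exp (-((‖h‖ ^ 2 / 2 : ℝ) : ℂ)) := by
  have hc : Continuous fun h : CameronMartin hS => Complex.exp (-((‖h‖ ^ 2 / 2 : ℝ) : ℂ)) := by
    fun_prop
  refine congrFun ((denseRange_covToCM hS).equalizer
    (continuous_integral_cexp_ell Measure.AbsolutelyContinuous.rfl) hc ?_) h
  ext v
  simp only [Function.comp_apply]
  rw [integral_cexp_ell_covToCM hμ Measure.AbsolutelyContinuous.rfl, hμ v, norm_sq_covToCM]

theorem map_ell (hμ : IsCenteredGaussian μ B) (h : CameronMartin hS) :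
    μ.map (ell μ hS h) = gaussianReal 0 (‖h‖₊ ^ 2) := by
  have hm := measurable_ell (μ := μ) h
  have := Measure.isProbabilityMeasure_map (μ := μ) hm.aemeasurable
  apply Measure.ext_of_charFun
  ext s
  rw [charFun_gaussianReal, charFun_apply, integral_map hm.aemeasurable
    (Measurable.aestronglyMeasurable (by fun_prop))]
  have h1 := integral_cexp_ell hμ (s • h)
  have h2 : ∫ x, Complex.exp (ell μ hS (s • h) x * Complex.I) ∂μ
      = ∫ x, Complex.exp ((⟪ell μ hS h x, s⟫ : ℝ) * Complex.I) ∂μ := by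
    refine integral_congr_ae ?_
    filter_upwards [ell_smul (μ := μ) s h] with x hx
    rw [hx]
    simp [mul_comm]
  rw [← h2, h1, norm_smul]
  congr 1
  push_cast
  simp only [mul_pow, Real.norm_eq_abs]
  rw [← Complex.ofReal_pow, sq_abs]
  push_cast
  simp
  ring

theorem indepFun_ell (hμ : IsCenteredGaussian μ B) {u w : CameronMartin hS} (huw : ⟪u, w⟫ = 0) :
    ell μ hS u ⟂ᵢ[μ] ell μ hS w := by
  have hmu := measurable_ell (μ := μ) u
  have hmw := measurable_ell (μ := μ) w
  rw [indepFun_iff_charFun_prod hmu.aemeasurable hmw.aemeasurable]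
  intro t
  rw [map_ell hμ, map_ell hμ, charFun_gaussianReal, charFun_gaussianReal, charFun_apply,
    integral_map (by fun_prop) (Measurable.aestronglyMeasurable (by fun_prop))]
  have h1 := integral_cexp_ell hμ (t.fst • u + t.snd • w)
  have h2 : ∫ x, Complex.exp (ell μ hS (t.fst • u + t.snd • w) x * Complex.I) ∂μ
      = ∫ x, Complex.exp ((⟪WithLp.toLp 2 (ell μ hS u x, ell μ hS w x), t⟫ : ℝ) * Complex.I) ∂μ := by
    refine integral_congr_ae ?_
    filter_upwards [ell_smul (μ := μ) t.fst u, ell_smul (μ := μ) t.snd w,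
      ell_add (μ := μ) (t.fst • u) (t.snd • w)] with x h1 h2 h3
    rw [h3, h1, h2]
    simp [WithLp.prod_inner_apply]
  have h3 : ‖t.fst • u + t.snd • w‖ ^ 2 = t.fst ^ 2 * ‖u‖ ^ 2 + t.snd ^ 2 * ‖w‖ ^ 2 := by
    rw [norm_add_sq_real, inner_smul_left, inner_smul_right, huw, norm_smul, norm_smul]
    simp [mul_pow]
  rw [← h2, h1, h3, ← Complex.exp_add]
  congr 1
  push_cast
  simp
  ring

/-- Split w into its projection c h and a part w' orthogonal to h. Then l_h and l_{w'} are
independent, and the l_h factor is the complex Gaussian moment generating function at 1 + c i. -/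
theorem integral_cexp_ell_add (hμ : IsCenteredGaussian μ B) (h w : CameronMartin hS) :
    ∫ x, Complex.exp (ell μ hS h x + ell μ hS w x * Complex.I) ∂μ
      = Complex.exp (((‖h‖ ^ 2 / 2 - ‖w‖ ^ 2 / 2 : ℝ) : ℂ) + (⟪h, w⟫ : ℝ) * Complex.I) := by
  -- For h = 0 the division gives c = 0, which still satisfies `hcn`.
  set c : ℝ := ⟪h, w⟫ / ‖h‖ ^ 2 with hc
  have hcn : c * ‖h‖ ^ 2 = ⟪h, w⟫ := by
    by_cases h0 : h = 0
    · simp [h0]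
    · rw [hc]
      have : ‖h‖ ≠ 0 := by simpa using h0
      field_simp
  set w' := w - c • h with hw'
  have horth : ⟪h, w'⟫ = 0 := by
    rw [hw', inner_sub_right, inner_smul_right, real_inner_self_eq_norm_sq, hcn, sub_self]
  have hw : w = c • h + w' := by simp [hw']
  have hnw : ‖w‖ ^ 2 = c ^ 2 * ‖h‖ ^ 2 + ‖w'‖ ^ 2 := by
    rw [hw, norm_add_sq_real, inner_smul_left, horth, norm_smul]
    simp [mul_pow]
  have hmh := measurable_ell (μ := μ) h
  have hmw := measurable_ell (μ := μ) w'
  have h1 : ∫ x, Complex.exp (ell μ hS h x + ell μ hS w x * Complex.I) ∂μ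
      = ∫ x, Complex.exp ((1 + c * Complex.I) * ell μ hS h x) *
          Complex.exp (ell μ hS w' x * Complex.I) ∂μ := by
    refine integral_congr_ae ?_
    rw [hw]
    filter_upwards [ell_smul (μ := μ) c h, ell_add (μ := μ) (c • h) w'] with x h1 h2
    rw [h2, h1, ← Complex.exp_add]
    congr 1
    push_cast
    ring
  have hind : (fun x => Complex.exp ((1 + c * Complex.I) * ell μ hS h x)) ⟂ᵢ[μ]
      (fun x => Complex.exp (ell μ hS w' x * Complex.I)) :=
    (indepFun_ell hμ horth).comp (φ := fun r : ℝ => Complex.exp ((1 + c * Complex.I) * r))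
      (ψ := fun r : ℝ => Complex.exp (r * Complex.I)) (by fun_prop) (by fun_prop)
  rw [h1, hind.integral_fun_mul_eq_mul_integral (Measurable.aestronglyMeasurable (by fun_prop))
    (Measurable.aestronglyMeasurable (by fun_prop)), integral_cexp_ell hμ]
  have h2 := complexMGF_gaussianReal (map_ell hμ h) (1 + c * Complex.I)
  rw [complexMGF] at h2
  rw [h2, ← Complex.exp_add, hnw, ← hcn]
  congr 1
  push_cast
  linear_combination (c ^ 2 * (‖h‖ : ℂ) ^ 2 / 2) * Complex.I_sq

theorem integrable_expVec (hμ : IsCenteredGaussian μ B) (h : CameronMartin hS) :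
    Integrable (expVec μ h) μ := by
  have h1 : Integrable (fun x => Real.exp (ell μ hS h x)) μ := by
    have := integrable_exp_mul_gaussianReal (μ := 0) (v := ‖h‖₊ ^ 2) 1
    rw [← map_ell hμ h, integrable_map_measure (by fun_prop) (measurable_ell h).aemeasurable] at this
    simpa [Function.comp_def] using this
  have h2 : expVec μ h = fun x => Real.exp (ell μ hS h x) * Real.exp (-(‖h‖ ^ 2 / 2)) := by
    ext x
    rw [expVec, ← Real.exp_add, sub_eq_add_neg]
  rw [h2]
  exact h1.mul_const _

/-- The density `exp_h`, with values in `ℝ≥0∞`. -/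
def expDensity (μ : Measure H) {hS : IsSqrtOf S B} (h : CameronMartin hS) (x : H) : ℝ≥0∞ :=
  ENNReal.ofReal (expVec μ h x)

theorem measurable_expDensity (h : CameronMartin hS) : Measurable (expDensity μ h) :=
  (measurable_expVec h).ennreal_ofReal

theorem expDensity_ne_zero (h : CameronMartin hS) (x : H) : expDensity μ h x ≠ 0 := by
  simpa [expDensity] using expVec_pos h x

theorem expDensity_ne_top (h : CameronMartin hS) (x : H) : expDensity μ h x ≠ ∞ :=
  ENNReal.ofReal_ne_top

/-- The **Cameron-Martin formula**. -/
theorem map_add_incl (hμ : IsCenteredGaussian μ B) (h : CameronMartin hS) :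
    μ.map (fun x => x + incl hS h) = μ.withDensity (expDensity μ h) := by
  have : SecondCountableTopology H := UniformSpace.secondCountable_of_separable H
  have hfin : IsFiniteMeasure (μ.withDensity (expDensity μ h)) :=
    isFiniteMeasure_withDensity_ofReal (integrable_expVec hμ h).2
  apply Measure.ext_of_charFun
  ext y
  rw [charFun_map_add_const, hμ y, charFun_apply,
    integral_withDensity_eq_integral_toReal_smul (measurable_expDensity h)
      (ae_of_all _ fun x => (expDensity_ne_top h x).lt_top)]
  -- Since ⟪y, x⟫ = l_{B y}(x) a.e., this is the mixed transform above at w = B y; its cross term is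
  -- the phase produced by the translation.
  have h1 : ∫ x, (expDensity μ h x).toReal • Complex.exp ((⟪x, y⟫ : ℝ) * Complex.I) ∂μ
      = ∫ x, Complex.exp (-((‖h‖ ^ 2 / 2 : ℝ) : ℂ)) *
        Complex.exp (ell μ hS h x + ell μ hS (covToCM hS y) x * Complex.I) ∂μ := by
    refine integral_congr_ae ?_
    filter_upwards [hμ.ell_covToCM hS y] with x hx
    rw [hx, expDensity, ENNReal.toReal_ofReal (expVec_pos h x).le, expVec, ← Complex.exp_add,
      real_inner_comm, Complex.real_smul, Complex.ofReal_exp, ← Complex.exp_add]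
    congr 1
    push_cast
    ring
  rw [h1, integral_const_mul, integral_cexp_ell_add hμ, norm_sq_covToCM, ← Complex.exp_add,
    real_inner_comm (covToCM hS y) h, inner_covToCM, ← Complex.exp_add,
    real_inner_comm y (incl hS h)]
  congr 1
  push_cast
  ring

theorem quasiMeasurePreserving_add_incl (hμ : IsCenteredGaussian μ B) (h : CameronMartin hS) :
    Measure.QuasiMeasurePreserving (fun x => x + incl hS h) μ μ := by
  refine ⟨by fun_prop, ?_⟩
  rw [map_add_incl hμ]
  exact withDensity_absolutelyContinuous _ _

/-- Exact when u ∈ B H. In the limit, a.e. convergence is used at x and at x + h, the latter because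
the translation is nonsingular. -/
theorem ell_add_incl (hμ : IsCenteredGaussian μ B) (u h : CameronMartin hS) :
    ∀ᵐ x ∂μ, ell μ hS u (x + incl hS h) = ell μ hS u x + ⟪u, h⟫ := by
  obtain ⟨v, hv⟩ := exists_seq_covToCM_tendsto u
  obtain ⟨ns, hns, hlim⟩ := exists_subseq_ell_tendsto (μ := μ) hv
  have hq := quasiMeasurePreserving_add_incl hμ h
  have hall : ∀ᵐ x ∂μ, ∀ n, ell μ hS (covToCM hS (v n)) x = ⟪v n, x⟫ :=
    ae_all_iff.mpr fun n => hμ.ell_covToCM hS (v n)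
  filter_upwards [hlim, hq.ae hlim, hall, hq.ae hall] with x h1 h2 h3 h4
  have h5 : Tendsto (fun n => ⟪covToCM hS (v (ns n)), h⟫) atTop (𝓝 ⟪u, h⟫) :=
    (hv.comp hns.tendsto_atTop).inner tendsto_const_nhds
  refine tendsto_nhds_unique h2 ((h1.add h5).congr fun n => ?_)
  rw [h3, h4, inner_covToCM, inner_add_right]

end Ell

/-! ### Hopf's criterion -/

section HopfCriterion

variable {X : Type*} [MeasurableSpace X] {μ : Measure X} {T : X ≃ᵐ X}

theorem measurable_zpow_perm (T : X ≃ᵐ X) (n : ℤ) :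
    Measurable ((T.toEquiv : Equiv.Perm X) ^ n) := by
  induction n using Int.induction_on with
  | zero => simpa using measurable_id
  | succ n ih =>
    rw [zpow_add_one]
    exact ih.comp T.measurable
  | pred n ih =>
    rw [zpow_sub_one]
    exact ih.comp T.symm.measurable

theorem zpow_perm_apply_add (σ : Equiv.Perm X) (m n : ℤ) (x : X) :
    (σ ^ m) ((σ ^ n) x) = (σ ^ (m + n)) x := by
  rw [zpow_add, Equiv.Perm.mul_apply]

theorem image_zpow_perm (σ : Equiv.Perm X) (n : ℤ) (W : Set X) :
    (σ ^ n) '' W = (σ ^ (-n)) ⁻¹' W := by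
  rw [zpow_neg]
  exact Equiv.image_eq_preimage_symm _ _

/-- The easy half of **Hopf's criterion**. -/
theorem isConservative_of_tsum_eq_top [IsFiniteMeasure μ] {ω : ℤ → X → ℝ≥0∞}
    (hm : ∀ n, Measurable (ω n))
    (hω : ∀ n, μ.map ⇑((T.toEquiv : Equiv.Perm X) ^ n) = μ.withDensity (ω n))
    (htop : ∀ᵐ x ∂μ, ∑' n, ω n x = ∞) : IsConservative μ T := by
  rintro W ⟨hW, hdisj⟩
  by_contra h0
  have hmeas : ∀ n : ℤ, MeasurableSet (((T.toEquiv : Equiv.Perm X) ^ n) '' W) := fun n => by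
    rw [image_zpow_perm]
    exact measurable_zpow_perm T _ hW
  -- Disjoint translates have finite total mass, yet that mass is the integral over W of the
  -- divergent series.
  have h1 : ∑' n : ℤ, μ (((T.toEquiv : Equiv.Perm X) ^ n) '' W) ≠ ∞ := by
    rw [← measure_iUnion hdisj hmeas]
    exact measure_ne_top _ _
  apply h1
  have h2 : ∀ n : ℤ, μ (((T.toEquiv : Equiv.Perm X) ^ n) '' W) = ∫⁻ x in W, ω (-n) x ∂μ :=
    fun n => by
      rw [image_zpow_perm, ← Measure.map_apply (measurable_zpow_perm T _) hW, hω,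
        withDensity_apply _ hW]
  simp_rw [h2]
  rw [← lintegral_tsum fun n => (hm (-n)).aemeasurable]
  have h3 : ∀ᵐ x ∂(μ.restrict W), ∑' n, ω (-n) x = ∞ := by
    filter_upwards [ae_restrict_of_ae htop] with x hx
    rw [← hx]
    exact (Equiv.neg ℤ).tsum_eq (fun n => ω n x)
  rw [lintegral_congr_ae h3, lintegral_const, Measure.restrict_apply_univ, ENNReal.top_mul h0]

theorem quasiMeasurePreserving_zpow {ω : ℤ → X → ℝ≥0∞}
    (hω : ∀ n, μ.map ⇑((T.toEquiv : Equiv.Perm X) ^ n) = μ.withDensity (ω n)) (n : ℤ) :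
    Measure.QuasiMeasurePreserving ⇑((T.toEquiv : Equiv.Perm X) ^ n) μ μ :=
  ⟨measurable_zpow_perm T n, by rw [hω]; exact withDensity_absolutelyContinuous _ _⟩

/-- If `e` is invertible, the image of the measure `g μ` under `e` is `g ∘ e⁻¹` times the image
of `μ`. -/
theorem map_withDensity_of_leftInverse {e e' : X → X} (he : Measurable e) (he' : Measurable e')
    (hinv : Function.LeftInverse e' e) {g : X → ℝ≥0∞} (hg : Measurable g) :
    (μ.withDensity g).map e = (μ.map e).withDensity (g ∘ e') := by
  ext s hs
  rw [Measure.map_apply he hs, withDensity_apply _ (he hs), withDensity_apply _ hs,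
    setLIntegral_map hs (hg.comp he') he]
  simp only [Function.comp_apply, hinv _]

/-- Uniqueness of densities for T^{n+m} = T^m ∘ T^n. Moving x along its orbit shifts the sequence n
↦ ω n x and rescales it by a constant. -/
theorem density_cocycle [IsFiniteMeasure μ] {ω : ℤ → X → ℝ≥0∞}
    (hm : ∀ n, Measurable (ω n))
    (hω : ∀ n, μ.map ⇑((T.toEquiv : Equiv.Perm X) ^ n) = μ.withDensity (ω n)) (m n : ℤ) :
    ∀ᵐ x ∂μ, ω (n + m) x = ω n (((T.toEquiv : Equiv.Perm X) ^ (-m)) x) * ω m x := by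
  set σ : Equiv.Perm X := T.toEquiv
  have hmn : Measurable (ω n ∘ ⇑(σ ^ (-m))) := (hm n).comp (measurable_zpow_perm T (-m))
  refine (withDensity_eq_iff_of_sigmaFinite (hm _).aemeasurable
    ((hmn.mul (hm m))).aemeasurable).mp ?_
  have h1 : ⇑(σ ^ (n + m)) = ⇑(σ ^ m) ∘ ⇑(σ ^ n) := by
    rw [add_comm, zpow_add]
    rfl
  rw [← hω (n + m), h1, ← Measure.map_map (measurable_zpow_perm T m) (measurable_zpow_perm T n),
    hω n, map_withDensity_of_leftInverse (e' := ⇑(σ ^ (-m))) (measurable_zpow_perm T m)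
      (measurable_zpow_perm T (-m)) (fun x => ?_) (hm n), hω m, mul_comm,
      withDensity_mul _ (hm m) hmn]
  rw [zpow_perm_apply_add]
  simp

/-- Only finitely many terms of a convergent series exceed a positive level. Asking for the first
maximum makes the index unique. -/
theorem exists_first_argmax {a : ℤ → ℝ≥0∞} (ha0 : a 0 ≠ 0) (ha : ∑' n, a n ≠ ∞) :
    ∃ m, (∀ n < m, a n < a m) ∧ ∀ n, a n ≤ a m := by
  have hfin : ∀ c : ℝ≥0∞, c ≠ 0 → {n | c ≤ a n}.Finite := fun c hc => by
    have := (ENNReal.tendsto_cofinite_zero_of_tsum_ne_top ha).eventually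
      (gt_mem_nhds (pos_iff_ne_zero.mpr hc))
    rw [eventually_cofinite] at this
    simpa using this
  obtain ⟨k, hk, hkmax⟩ := Set.exists_max_image _ a (hfin _ ha0) ⟨0, le_refl (a 0)⟩
  have hk0 : a k ≠ 0 := (pos_iff_ne_zero.mpr ha0).trans_le hk |>.ne'
  have hkall : ∀ n, a n ≤ a k := fun n => by
    rcases le_total (a 0) (a n) with h | h
    · exact hkmax n h
    · exact h.trans hk
  obtain ⟨m, hm, hmin⟩ := Set.exists_min_image _ id (hfin _ hk0) ⟨k, le_refl (a k)⟩
  have hmk : a m = a k := le_antisymm (hkall m) hm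
  refine ⟨m, fun n hn => ?_, fun n => hmk ▸ hkall n⟩
  rw [hmk]
  by_contra! h
  exact absurd (hmin n h) (not_le.mpr hn)

/-- The other half of **Hopf's criterion**. -/
theorem isTotallyDissipative_of_tsum_ne_top [IsFiniteMeasure μ] {ω : ℤ → X → ℝ≥0∞}
    (hm : ∀ n, Measurable (ω n)) (h0 : ∀ n x, ω n x ≠ 0) (htop : ∀ n x, ω n x ≠ ∞)
    (hω : ∀ n, μ.map ⇑((T.toEquiv : Equiv.Perm X) ^ n) = μ.withDensity (ω n))
    (hsum : ∀ᵐ x ∂μ, ∑' n, ω n x ≠ ∞) : IsTotallyDissipative μ T := by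
  set σ : Equiv.Perm X := T.toEquiv with hσ
  let C : Set X := {x | (∀ m n : ℤ, ω (n + m) x = ω n ((σ ^ (-m)) x) * ω m x) ∧ ∑' n, ω n x ≠ ∞}
  have hCm : MeasurableSet C := by
    have h1 : ∀ m n : ℤ, MeasurableSet {x | ω (n + m) x = ω n ((σ ^ (-m)) x) * ω m x} :=
      fun m n => measurableSet_eq_fun (hm _)
        (((hm n).comp (measurable_zpow_perm T (-m))).mul (hm m))
    have h2 : MeasurableSet {x | ∑' n, ω n x ≠ ∞} :=
      (measurableSet_eq_fun (Measurable.tsum hm) measurable_const).compl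
    have h3 : C = (⋂ m : ℤ, ⋂ n : ℤ, {x | ω (n + m) x = ω n ((σ ^ (-m)) x) * ω m x}) ∩
        {x | ∑' n, ω n x ≠ ∞} := by
      ext x
      simp [C]
    rw [h3]
    exact (MeasurableSet.iInter fun m => MeasurableSet.iInter fun n => h1 m n).inter h2
  have hC : ∀ᵐ x ∂μ, x ∈ C := by
    filter_upwards [ae_all_iff.mpr fun m => ae_all_iff.mpr fun n => density_cocycle hm hω m n,
      hsum] with x h1 h2
    exact ⟨h1, h2⟩
  -- The largest invariant subset of C, so that the cocycle identity holds along whole orbits.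
  let G : Set X := {x | ∀ k : ℤ, (σ ^ k) x ∈ C}
  have hGm : MeasurableSet G := by
    have : G = ⋂ k : ℤ, (σ ^ k) ⁻¹' C := by
      ext x
      simp [G]
    rw [this]
    exact MeasurableSet.iInter fun k => measurable_zpow_perm T k hCm
  have hG : ∀ᵐ x ∂μ, x ∈ G :=
    ae_all_iff.mpr fun k => (quasiMeasurePreserving_zpow hω k).ae hC
  have hGinv : ∀ (k : ℤ) x, (σ ^ k) x ∈ G → x ∈ G := fun k x hx j => by
    have := hx (j - k)
    rwa [zpow_perm_apply_add, sub_add_cancel] at this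
  have hGinv' : ∀ (k : ℤ) x, x ∈ G → (σ ^ k) x ∈ G := fun k x hx j => by
    rw [zpow_perm_apply_add]
    exact hx _
  -- The points whose densities have their first maximum at n = 0. By the cocycle, y ∈ T^m W exactly
  -- when the first maximum for y is at m (`hkey`), so the translates partition G.
  let W : Set X := {x | x ∈ G ∧ (∀ n < 0, ω n x < 1) ∧ ∀ n, ω n x ≤ 1}
  have hWm : MeasurableSet W := by
    have : W = G ∩ ((⋂ n : ℤ, ⋂ _ : n < 0, {x | ω n x < 1}) ∩ ⋂ n : ℤ, {x | ω n x ≤ 1}) := by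
      ext x
      simp only [W, Set.mem_ofPred_eq, Set.mem_inter_iff, Set.mem_iInter]
    rw [this]
    refine hGm.inter ((MeasurableSet.iInter fun n => MeasurableSet.iInter fun _ => ?_).inter
      (MeasurableSet.iInter fun n => ?_))
    · exact measurableSet_lt (hm n) measurable_const
    · exact measurableSet_le (hm n) measurable_const
  have hkey : ∀ x ∈ G, ∀ m : ℤ, (σ ^ (-m)) x ∈ W ↔
      (∀ n < m, ω n x < ω m x) ∧ ∀ n, ω n x ≤ ω m x := by
    intro x hx m
    have hc : ∀ n : ℤ, ω (n + m) x = ω n ((σ ^ (-m)) x) * ω m x := fun n => by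
      have h := (hx 0).1 m n
      simpa using h
    have hlt : ∀ n : ℤ, ω n ((σ ^ (-m)) x) < 1 ↔ ω (n + m) x < ω m x := fun n => by
      rw [hc n]
      conv_lhs => rw [← ENNReal.mul_lt_mul_iff_left (h0 m x) (htop m x), one_mul]
    have hle : ∀ n : ℤ, ω n ((σ ^ (-m)) x) ≤ 1 ↔ ω (n + m) x ≤ ω m x := fun n => by
      rw [hc n]
      conv_lhs => rw [← ENNReal.mul_le_mul_iff_left (h0 m x) (htop m x), one_mul]
    constructor
    · rintro ⟨-, h1, h2⟩
      refine ⟨fun n hn => ?_, fun n => ?_⟩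
      · have := (hlt (n - m)).mp (h1 _ (by omega))
        rwa [sub_add_cancel] at this
      · have := (hle (n - m)).mp (h2 _)
        rwa [sub_add_cancel] at this
    · rintro ⟨h1, h2⟩
      exact ⟨hGinv' _ _ hx, fun n hn => (hlt n).mpr (h1 _ (by omega)),
        fun n => (hle n).mpr (h2 _)⟩
  refine ⟨W, ⟨hWm, fun m n hmn => ?_⟩, ?_⟩
  · change Disjoint _ _
    rw [image_zpow_perm, image_zpow_perm, Set.disjoint_left]
    intro y hym hyn
    have hyG : y ∈ G := hGinv _ _ hym.1
    have h1 := (hkey y hyG m).mp hym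
    have h2 := (hkey y hyG n).mp hyn
    rcases lt_or_gt_of_ne hmn with h | h
    · exact absurd (h2.1 m h) (not_lt.mpr (h1.2 n))
    · exact absurd (h1.1 n h) (not_lt.mpr (h2.2 m))
  · refine measure_mono_null (fun y hy => ?_) (ae_iff.mp hG)
    intro hyG
    apply hy
    have hs : ∑' n, ω n y ≠ ∞ := by simpa using (hyG 0).2
    obtain ⟨m, hm'⟩ := exists_first_argmax (h0 0 y) hs
    rw [Set.mem_iUnion]
    refine ⟨m, ?_⟩
    rw [image_zpow_perm]
    exact (hkey y hyG m).mpr hm'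

end HopfCriterion

/-! ### Affine isometries and the action of Gaussian transformations -/

namespace Aff

variable {K : Type*} [NormedAddCommGroup K] [InnerProductSpace ℝ K]

/-- The action `h ↦ f + V h` of `A = (f, V)`. -/
def toPerm (A : Aff K) : Equiv.Perm K := A.V.toEquiv.trans (Equiv.addLeft A.f)

theorem toPerm_apply (A : Aff K) (h : K) : A.toPerm h = A.f + A.V h := rfl

/-- The orbit of the origin under an affine isometry. -/
def orbit (A : Aff K) (n : ℤ) : K := (A.toPerm ^ n) 0

theorem orbit_zero (A : Aff K) : A.orbit 0 = 0 := rfl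

theorem orbit_add_one (A : Aff K) (n : ℤ) : A.orbit (n + 1) = A.f + A.V (A.orbit n) := by
  rw [orbit, add_comm, zpow_one_add]
  rfl

theorem orbit_sub_one (A : Aff K) (n : ℤ) : A.orbit (n - 1) = A.V.symm (A.orbit n - A.f) := by
  have h := A.orbit_add_one (n - 1)
  rw [sub_add_cancel] at h
  simp [h]

theorem orbit_dilate (A : Aff K) (t : ℝ) (n : ℤ) : (A.dilate t).orbit n = t • A.orbit n := by
  induction n using Int.induction_on with
  | zero => simp [orbit_zero]
  | succ n ih =>
    rw [orbit_add_one, orbit_add_one, ih]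
    simp [dilate]
  | pred n ih =>
    rw [orbit_sub_one, orbit_sub_one, ih]
    simp [dilate, smul_sub]

theorem norm_orbit_add_one_sub (A : Aff K) (n : ℤ) : ‖A.orbit (n + 1) - A.orbit n‖ = ‖A.f‖ := by
  induction n using Int.induction_on with
  | zero =>
    rw [orbit_add_one, orbit_zero]
    simp
  | succ n ih =>
    rw [← ih, orbit_add_one A (n + 1)]
    nth_rewrite 2 [orbit_add_one]
    rw [add_sub_add_left_eq_sub, ← map_sub, A.V.norm_map]
  | pred n ih =>
    rw [← ih, sub_add_cancel, orbit_sub_one]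
    nth_rewrite 1 [show (-(n : ℤ)) = -n + 1 - 1 by ring]
    rw [orbit_sub_one, ← map_sub, sub_sub_sub_cancel_right, A.V.symm.norm_map]

/-- Moving V⁻¹ to the other side turns the pairing into ⟪f - (A^{n+1} 0 - A^n 0), g⟫, and
consecutive orbit points are at distance ‖f‖. -/
theorem abs_inner_orbit_le (A : Aff K) (n : ℤ) (g : K) :
    |⟪A.orbit n, g - A.V.symm g⟫| ≤ 2 * ‖A.f‖ * ‖g‖ := by
  have h1 : ⟪A.orbit n, g - A.V.symm g⟫ = ⟪A.f - (A.orbit (n + 1) - A.orbit n), g⟫ := by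
    rw [orbit_add_one, inner_sub_right, ← A.V.inner_map_map (A.orbit n) (A.V.symm g),
      A.V.apply_symm_apply, ← inner_sub_left]
    congr 1
    abel
  rw [h1]
  refine (abs_real_inner_le_norm _ _).trans ?_
  gcongr
  refine (norm_sub_le _ _).trans ?_
  rw [norm_orbit_add_one_sub]
  linarith

/-- The orthogonal complement of the range of 1 - V⁻¹ consists of V-invariant vectors. -/
theorem dense_range_sub_symm [CompleteSpace K] (A : Aff K) (hV : ∀ h, A.V h = h → h = 0) :
    Dense (Set.range fun g => g - A.V.symm g) := by
  let L : K →ₗ[ℝ] K := LinearMap.id - A.V.symm.toLinearEquiv.toLinearMap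
  have h : (LinearMap.range L)ᗮ = ⊥ := by
    rw [Submodule.eq_bot_iff]
    intro x hx
    refine hV x (ext_inner_right ℝ fun g => ?_)
    have h1 := hx _ (LinearMap.mem_range_self L g)
    have h2 : ⟪g - A.V.symm g, x⟫ = 0 := h1
    rw [inner_sub_left, sub_eq_zero] at h2
    rw [← A.V.symm.inner_map_map, A.V.symm_apply_apply, real_inner_comm, ← h2, real_inner_comm]
  rw [← Submodule.topologicalClosure_eq_top_iff] at h
  exact Submodule.dense_iff_topologicalClosure_eq_top.mpr h

end Aff

/-! ### Action of Gaussian transformations on exponential densities -/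

variable {H : Type*} [NormedAddCommGroup H] [InnerProductSpace ℝ H] {S B : H →L[ℝ] H}
  [CompleteSpace H] [TopologicalSpace.SeparableSpace H] [MeasurableSpace H] [BorelSpace H]
  {μ : Measure H} [IsProbabilityMeasure μ] {hS : IsSqrtOf S B}

open CameronMartin

theorem expVec_zero : expVec μ (0 : CameronMartin hS) = 1 := by
  ext x
  simp [expVec]

/-- Halving f turns exp_f into its square root, so the Weyl image takes the Koopman shape: a
composed function times the root of a density. -/
theorem weylExp_dilate_half (A : Aff (CameronMartin hS)) (h : CameronMartin hS) :
    weylExp μ (A.dilate (1 / 2)) h =ᵐ[μ] fun x =>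
      Real.exp (ell μ hS (A.V h) x - ⟪A.f, A.V h⟫ - ‖h‖ ^ 2 / 2) * √(expVec μ A.f x) := by
  have h1 : (A.dilate (1 / 2)).f = (1 / 2 : ℝ) • A.f := rfl
  have h2 : (A.dilate (1 / 2)).V = A.V := rfl
  filter_upwards [ell_add (μ := μ) ((1 / 2 : ℝ) • A.f) (A.V h), ell_smul (μ := μ) (1 / 2 : ℝ) A.f]
    with x hx1 hx2
  rw [weylExp, expVec, expVec, h1, h2, hx1, hx2, ← Real.exp_half, ← Real.exp_add, ← Real.exp_add,
    norm_add_sq_real, A.V.norm_map, inner_smul_left, norm_smul]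
  congr 1
  simp
  ring

namespace IsGaussianTransformation

variable {A : Aff (CameronMartin hS)} {T : H ≃ᵐ H}

theorem sqrt_rnDeriv (hT : IsGaussianTransformation μ A T) :
    ∀ᵐ x ∂μ, √((μ.map T).rnDeriv μ x).toReal = √(expVec μ A.f x) := by
  filter_upwards [hT.koopman_eq 0, weylExp_dilate_half (μ := μ) A 0] with x h1 h2
  rw [h2, koopman, expVec_zero] at h1
  simpa using h1

theorem map_eq (hT : IsGaussianTransformation μ A T) :
    μ.map T = μ.withDensity (expDensity μ A.f) := by
  rw [← Measure.withDensity_rnDeriv_eq _ _ hT.quasi.absolutelyContinuous]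
  refine withDensity_congr_ae ?_
  filter_upwards [hT.sqrt_rnDeriv, Measure.rnDeriv_lt_top (μ.map T) μ] with x h1 h2
  rw [Real.sqrt_inj ENNReal.toReal_nonneg (expVec_pos _ _).le] at h1
  rw [expDensity, ← h1, ENNReal.ofReal_toReal h2.ne]

/-- The density factor is positive and cancels; taking logarithms, the norm terms agree because V is
isometric. -/
theorem ell_symm (hT : IsGaussianTransformation μ A T) (h : CameronMartin hS) :
    ∀ᵐ x ∂μ, ell μ hS h (T.symm x) = ell μ hS (A.V h) x - ⟪A.f, A.V h⟫ := by
  filter_upwards [hT.koopman_eq h, weylExp_dilate_half (μ := μ) A h, hT.sqrt_rnDeriv]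
    with x h1 h2 h3
  rw [h2, koopman, h3] at h1
  have h4 := mul_right_cancel₀ (Real.sqrt_pos.mpr (expVec_pos _ _)).ne' h1
  rw [expVec, Real.exp_eq_exp] at h4
  linarith

theorem map_expDensity (hT : IsGaussianTransformation μ A T) (u : CameronMartin hS) :
    (μ.withDensity (expDensity μ u)).map T = μ.withDensity (expDensity μ (A.f + A.V u)) := by
  rw [map_withDensity_of_leftInverse T.measurable T.symm.measurable T.symm_apply_apply
    (measurable_expDensity u), hT.map_eq, ← withDensity_mul _ (measurable_expDensity _)
    ((measurable_expDensity u).comp T.symm.measurable)]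
  refine withDensity_congr_ae ?_
  filter_upwards [hT.ell_symm u, ell_add (μ := μ) A.f (A.V u)] with x h1 h2
  rw [Pi.mul_apply, Function.comp_apply, expDensity, expDensity, expDensity,
    ← ENNReal.ofReal_mul (expVec_pos _ _).le, expVec, expVec, expVec, h1, h2, ← Real.exp_add,
    norm_add_sq_real, A.V.norm_map]
  congr 2
  ring

theorem map_symm_expDensity (hT : IsGaussianTransformation μ A T) (u : CameronMartin hS) :
    (μ.withDensity (expDensity μ u)).map T.symm
      = μ.withDensity (expDensity μ (A.V.symm (u - A.f))) := by
  have h := hT.map_expDensity (A.V.symm (u - A.f))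
  rw [A.V.apply_symm_apply, add_sub_cancel] at h
  rw [← h, T.map_symm_map]

theorem map_zpow (hT : IsGaussianTransformation μ A T) (n : ℤ) :
    μ.map ⇑((T.toEquiv : Equiv.Perm H) ^ n) = μ.withDensity (expDensity μ (A.orbit n)) := by
  set σ : Equiv.Perm H := T.toEquiv with hσ
  induction n using Int.induction_on with
  | zero =>
    have h1 : expDensity μ (0 : CameronMartin hS) = 1 := by
      ext x
      simp [expDensity, expVec_zero]
    rw [Aff.orbit_zero, h1, withDensity_one]
    exact Measure.map_id
  | succ n ih =>
    have h1 : ⇑(σ ^ ((n : ℤ) + 1)) = T ∘ ⇑(σ ^ (n : ℤ)) := by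
      rw [add_comm, zpow_one_add]
      rfl
    rw [h1, ← Measure.map_map T.measurable (measurable_zpow_perm T _), ih, hT.map_expDensity,
      Aff.orbit_add_one]
  | pred n ih =>
    have h1 : ⇑(σ ^ (-(n : ℤ) - 1)) = T.symm ∘ ⇑(σ ^ (-(n : ℤ))) := by
      rw [sub_eq_neg_add, zpow_add, zpow_neg_one]
      rfl
    rw [h1, ← Measure.map_map T.symm.measurable (measurable_zpow_perm T _), ih,
      hT.map_symm_expDensity, Aff.orbit_sub_one]

end IsGaussianTransformation

/-! ### The zero-one law -/

theorem lintegral_expDensity (hμ : IsCenteredGaussian μ B) (h : CameronMartin hS) :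
    ∫⁻ x, expDensity μ h x ∂μ = 1 := by
  rw [← setLIntegral_univ, ← withDensity_apply _ MeasurableSet.univ, ← map_add_incl hμ,
    Measure.map_apply (by fun_prop) MeasurableSet.univ]
  simp

/-- Reduces equality of moment generating functions under μ and ν to equality of the integrals of
exponential densities. -/
theorem mgf_ell_eq {ν : Measure H} (hν : ν ≪ μ) (h : CameronMartin hS) (s : ℝ) :
    mgf (ell μ hS h) ν s
      = Real.exp (‖s • h‖ ^ 2 / 2) * (∫⁻ x, expDensity μ (s • h) x ∂ν).toReal := by
  have h1 : (∫⁻ x, expDensity μ (s • h) x ∂ν).toReal = ∫ x, expVec μ (s • h) x ∂ν := by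
    rw [integral_eq_lintegral_of_nonneg_ae (ae_of_all _ fun x => (expVec_pos _ x).le)
      (measurable_expVec _).aestronglyMeasurable]
    rfl
  rw [h1, ← integral_const_mul, mgf]
  refine integral_congr_ae ?_
  filter_upwards [hν (ell_smul (μ := μ) s h)] with x hx
  rw [expVec, hx, ← Real.exp_add]
  congr 1
  ring

/-- A Gaussian **zero-one law**: a set that is invariant (modulo null sets) under the translations
by a dense subspace of the Cameron-Martin space is trivial. -/
theorem measure_eq_zero_or_one_of_translation_invariant (hμ : IsCenteredGaussian μ B) {D : Set H}
    (hD : MeasurableSet D) {E : Set (CameronMartin hS)} (hE : Dense E)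
    (hsmul : ∀ (s : ℝ), ∀ h ∈ E, s • h ∈ E)
    (hinv : ∀ h ∈ E, ∀ᵐ x ∂μ, x + incl hS h ∈ D ↔ x ∈ D) : μ D = 0 ∨ μ D = 1 := by
  have : SecondCountableTopology H := UniformSpace.secondCountable_of_separable H
  by_cases h0 : μ D = 0
  · exact Or.inl h0
  right
  -- The aim is μ = ν, which forces μ D = ν D = 1. Invariance of D makes every exp_h, h ∈ E, have
  -- ν-integral 1, as it has under μ.
  set ν := μ[|D] with hν
  have hνp : IsProbabilityMeasure ν := cond_isProbabilityMeasure h0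
  have hνac : ν ≪ μ := cond_absolutelyContinuous
  have h1 : ∀ h ∈ E, ∫⁻ x, expDensity μ h x ∂ν = 1 := by
    intro h hh
    have h2 : ∫⁻ x in D, expDensity μ h x ∂μ = μ D := by
      rw [← withDensity_apply _ hD, ← map_add_incl hμ, Measure.map_apply (by fun_prop) hD]
      exact measure_congr (eventuallyEq_set.mpr (hinv h hh))
    rw [hν, ProbabilityTheory.cond, lintegral_smul_measure, h2, smul_eq_mul,
      ENNReal.inv_mul_cancel h0 (measure_ne_top _ _)]
  have h2 : ∀ h ∈ E, ∫ x, Complex.exp (ell μ hS h x * Complex.I) ∂μ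
      = ∫ x, Complex.exp (ell μ hS h x * Complex.I) ∂ν := by
    intro h hh
    have h3 : mgf (ell μ hS h) μ = mgf (ell μ hS h) ν := by
      ext s
      rw [mgf_ell_eq Measure.AbsolutelyContinuous.rfl, mgf_ell_eq hνac, lintegral_expDensity hμ,
        h1 _ (hsmul s h hh)]
    have h4 : integrableExpSet (ell μ hS h) μ = Set.univ := by
      rw [Set.eq_univ_iff_forall]
      intro s
      have := integrable_exp_mul_gaussianReal (μ := 0) (v := ‖h‖₊ ^ 2) s
      rwa [← map_ell hμ h, integrable_map_measure (by fun_prop)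
        (measurable_ell h).aemeasurable] at this
    -- Analytic continuation from the real line to i, valid since all exponential moments are
    -- finite.
    have h5 := eqOn_complexMGF_of_mgf h3 (x := Complex.I) (by simp [h4])
    simp only [complexMGF] at h5
    simpa only [mul_comm] using h5
  have h3 := Continuous.ext_on hE
    (continuous_integral_cexp_ell (hS := hS) (μ := μ) Measure.AbsolutelyContinuous.rfl)
    (continuous_integral_cexp_ell hνac) h2
  have h4 : μ = ν := by
    apply Measure.ext_of_charFun
    ext v
    rw [← integral_cexp_ell_covToCM (hS := hS) hμ Measure.AbsolutelyContinuous.rfl,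
      ← integral_cexp_ell_covToCM (hS := hS) hμ hνac]
    exact congrFun h3 _
  rw [h4, hν]
  exact cond_apply_self h0 (measure_ne_top _ _)

/-- The set where the series of the densities `exp_{u n}` converges. -/
def summableSet (μ : Measure H) {hS : IsSqrtOf S B} (u : ℤ → CameronMartin hS) : Set H :=
  {x | ∑' n, expDensity μ (u n) x ≠ ∞}

theorem measurableSet_summableSet (u : ℤ → CameronMartin hS) :
    MeasurableSet (summableSet μ u) :=
  (measurableSet_eq_fun (Measurable.tsum fun n => measurable_expDensity (u n))
    measurable_const).compl

theorem ae_add_incl_mem_summableSet_of_bounded (hμ : IsCenteredGaussian μ B)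
    {u : ℤ → CameronMartin hS} {h : CameronMartin hS} {C : ℝ} (hC : ∀ n, |⟪u n, h⟫| ≤ C) :
    ∀ᵐ x ∂μ, x ∈ summableSet μ u → x + incl hS h ∈ summableSet μ u := by
  filter_upwards [ae_all_iff.mpr fun n => ell_add_incl hμ (u n) h] with x hx hs
  have h1 : ∀ n, expDensity μ (u n) (x + incl hS h)
      ≤ ENNReal.ofReal (Real.exp C) * expDensity μ (u n) x := by
    intro n
    rw [expDensity, expDensity, ← ENNReal.ofReal_mul (Real.exp_pos _).le, expVec, expVec,
      ← Real.exp_add, hx n]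
    refine ENNReal.ofReal_le_ofReal (Real.exp_le_exp.mpr ?_)
    linarith [(abs_le.mp (hC n)).2]
  refine ((ENNReal.tsum_le_tsum h1).trans_lt ?_).ne
  rw [ENNReal.tsum_mul_left]
  exact ENNReal.mul_lt_top ENNReal.ofReal_lt_top hs.lt_top

theorem ae_add_incl_mem_summableSet_iff (hμ : IsCenteredGaussian μ B)
    {u : ℤ → CameronMartin hS} {h : CameronMartin hS} {C : ℝ} (hC : ∀ n, |⟪u n, h⟫| ≤ C) :
    ∀ᵐ x ∂μ, x + incl hS h ∈ summableSet μ u ↔ x ∈ summableSet μ u := by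
  have hq := quasiMeasurePreserving_add_incl hμ h
  have h2 := ae_add_incl_mem_summableSet_of_bounded hμ (u := u) (h := -h) (C := C)
    (by simpa using hC)
  filter_upwards [ae_add_incl_mem_summableSet_of_bounded hμ hC, hq.ae h2] with x hx1 hx2
  exact ⟨fun hx => by simpa using hx2 hx, hx1⟩

theorem measure_summableSet_orbit (hμ : IsCenteredGaussian μ B) (A : Aff (CameronMartin hS))
    (hV : ∀ h, A.V h = h → h = 0) :
    μ (summableSet μ A.orbit) = 0 ∨ μ (summableSet μ A.orbit) = 1 := by
  have := CameronMartin.complete hS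
  refine measure_eq_zero_or_one_of_translation_invariant hμ (measurableSet_summableSet _)
    (A.dense_range_sub_symm hV) ?_ ?_
  · rintro s _ ⟨g, rfl⟩
    exact ⟨s • g, by simp [smul_sub]⟩
  · rintro _ ⟨g, rfl⟩
    exact ae_add_incl_mem_summableSet_iff hμ fun n => A.abs_inner_orbit_le n g

/-! ### Monotonicity -/

theorem map_rotation (hμ : IsCenteredGaussian μ B) {a b : ℝ} (hab : a ^ 2 + b ^ 2 = 1) :
    (μ.prod μ).map (fun p : H × H => a • p.1 + b • p.2) = μ := by
  have : SecondCountableTopology H := UniformSpace.secondCountable_of_separable H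
  have hm : Measurable fun p : H × H => a • p.1 + b • p.2 := by fun_prop
  have := Measure.isProbabilityMeasure_map (μ := μ.prod μ) hm.aemeasurable
  apply Measure.ext_of_charFun
  ext v
  rw [charFun_apply, integral_map hm.aemeasurable (Measurable.aestronglyMeasurable (by fun_prop))]
  have h1 : ∀ p : H × H, Complex.exp ((⟪a • p.1 + b • p.2, v⟫ : ℝ) * Complex.I)
      = Complex.exp ((⟪p.1, a • v⟫ : ℝ) * Complex.I)
        * Complex.exp ((⟪p.2, b • v⟫ : ℝ) * Complex.I) := by
    intro p
    rw [← Complex.exp_add, inner_add_left, real_inner_smul_left, real_inner_smul_left,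
      real_inner_smul_right, real_inner_smul_right]
    congr 1
    push_cast
    ring
  simp_rw [h1]
  rw [integral_prod_mul (fun x => Complex.exp ((⟪x, a • v⟫ : ℝ) * Complex.I))
    (fun x => Complex.exp ((⟪x, b • v⟫ : ℝ) * Complex.I)), ← charFun_apply, ← charFun_apply, hμ,
    hμ, hμ, ← Complex.exp_add]
  simp only [map_smul, real_inner_smul_left, real_inner_smul_right]
  congr 1
  have h2 : (a : ℂ) ^ 2 + (b : ℂ) ^ 2 = 1 := by exact_mod_cast hab
  push_cast
  linear_combination -(⟪B v, v⟫ : ℂ) / 2 * h2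

theorem ell_rotation (hμ : IsCenteredGaussian μ B) {a b : ℝ} (hab : a ^ 2 + b ^ 2 = 1)
    (u : CameronMartin hS) :
    ∀ᵐ p ∂(μ.prod μ), ell μ hS u (a • p.1 + b • p.2) = a * ell μ hS u p.1 + b * ell μ hS u p.2 := by
  have : SecondCountableTopology H := UniformSpace.secondCountable_of_separable H
  obtain ⟨v, hv⟩ := exists_seq_covToCM_tendsto u
  obtain ⟨ns, hns, hlim⟩ := exists_subseq_ell_tendsto (μ := μ) hv
  have hq : Measure.QuasiMeasurePreserving (fun p : H × H => a • p.1 + b • p.2) (μ.prod μ) μ :=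
    ⟨by fun_prop, (map_rotation hμ hab).absolutelyContinuous⟩
  have hall : ∀ᵐ x ∂μ, ∀ n, ell μ hS (covToCM hS (v n)) x = ⟪v n, x⟫ :=
    ae_all_iff.mpr fun n => hμ.ell_covToCM hS (v n)
  have hgood : ∀ᵐ x ∂μ, Tendsto (fun n => ⟪v (ns n), x⟫) atTop (𝓝 (ell μ hS u x)) := by
    filter_upwards [hlim, hall] with x h1 h2
    simpa only [h2] using h1
  filter_upwards [hq.ae hgood, Measure.quasiMeasurePreserving_fst.ae hgood,
    Measure.quasiMeasurePreserving_snd.ae hgood] with p h1 h2 h3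
  refine tendsto_nhds_unique h1 (((h2.const_mul a).add (h3.const_mul b)).congr fun n => ?_)
  rw [inner_add_right, real_inner_smul_right, real_inner_smul_right]

theorem ae_mem_summableSet_of_lt (hμ : IsCenteredGaussian μ B) {u : ℤ → CameronMartin hS}
    {t s : ℝ} (ht : 0 < t) (hts : t < s) (hsum : ∀ᵐ x ∂μ, x ∈ summableSet μ fun n => t • u n) :
    ∀ᵐ x ∂μ, x ∈ summableSet μ fun n => s • u n := by
  have : SecondCountableTopology H := UniformSpace.secondCountable_of_separable H
  have hs : 0 < s := ht.trans hts
  -- Chosen so that (t/s, r/s) is a unit vector and the terms ‖s u‖²/2 split as ‖t u‖²/2 + ‖r u‖²/2.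
  set r : ℝ := √(s ^ 2 - t ^ 2) with hr
  have hr2 : r ^ 2 = s ^ 2 - t ^ 2 := Real.sq_sqrt (by nlinarith)
  have hab : (t / s) ^ 2 + (r / s) ^ 2 = 1 := by
    rw [div_pow, div_pow, hr2]
    field_simp
    ring
  have hsplit : ∀ n, ∀ᵐ p ∂(μ.prod μ), expDensity μ (s • u n) ((t / s) • p.1 + (r / s) • p.2)
      = expDensity μ (t • u n) p.1 * expDensity μ (r • u n) p.2 := by
    intro n
    have hsm := fun c : ℝ => ell_smul (μ := μ) c (u n)
    filter_upwards [ell_rotation hμ hab (s • u n),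
      Measure.quasiMeasurePreserving_fst.ae (hsm s), Measure.quasiMeasurePreserving_snd.ae (hsm s),
      Measure.quasiMeasurePreserving_fst.ae (hsm t), Measure.quasiMeasurePreserving_snd.ae (hsm r)]
      with p h1 h2 h3 h4 h5
    rw [expDensity, expDensity, expDensity, ← ENNReal.ofReal_mul (expVec_pos _ _).le, expVec,
      expVec, expVec, ← Real.exp_add, h1, h2, h3, h4, h5, norm_smul, norm_smul, norm_smul]
    congr 2
    simp only [mul_pow, Real.norm_eq_abs, sq_abs, hr2]
    field_simp
    ring
  have hprod : ∀ᵐ p ∂(μ.prod μ),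
      ∑' n, expDensity μ (t • u n) p.1 * expDensity μ (r • u n) p.2 ≠ ∞ := by
    have hmeas : Measurable fun p : H × H =>
        ∑' n, expDensity μ (t • u n) p.1 * expDensity μ (r • u n) p.2 :=
      Measurable.tsum fun n => ((measurable_expDensity _).comp measurable_fst).mul
        ((measurable_expDensity _).comp measurable_snd)
    refine (Measure.ae_prod_iff_ae_ae (measurableSet_eq_fun hmeas measurable_const).compl).mpr ?_
    filter_upwards [hsum] with x hx
    -- For fixed x, integrating out y leaves the series at parameter t, finite by assumption.
    have h1 : ∫⁻ y, ∑' n, expDensity μ (t • u n) x * expDensity μ (r • u n) y ∂μ ≠ ∞ := by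
      rw [lintegral_tsum fun n => ((measurable_expDensity _).const_mul _).aemeasurable]
      simp_rw [lintegral_const_mul _ (measurable_expDensity _), lintegral_expDensity hμ, mul_one]
      exact hx
    have h2 : Measurable fun y => ∑' n, expDensity μ (t • u n) x * expDensity μ (r • u n) y :=
      Measurable.tsum fun n => (measurable_expDensity _).const_mul _
    filter_upwards [ae_lt_top h2 h1] with y hy
    exact hy.ne
  have hφ : Measurable fun p : H × H => (t / s) • p.1 + (r / s) • p.2 := by fun_prop
  have h3 : ∀ᵐ p ∂(μ.prod μ),
      (t / s) • p.1 + (r / s) • p.2 ∈ summableSet μ fun n => s • u n := by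
    filter_upwards [hprod, ae_all_iff.mpr hsplit] with p h1 h2
    simpa only [summableSet, Set.mem_ofPred_eq, h2] using h1
  have h4 := (ae_map_iff (p := fun x => x ∈ summableSet μ fun n => s • u n) hφ.aemeasurable
    (measurableSet_summableSet _)).mpr h3
  rwa [map_rotation hμ hab] at h4

/-- The transformations `T_{α_t A}` pass from conservative to totally dissipative at some `t`. -/
theorem exists_tdiss (hμ : IsCenteredGaussian μ B) (A : Aff (CameronMartin hS))
    (hV : ∀ h, A.V h = h → h = 0) :
    ∃ tdiss : ℝ≥0∞, ∀ t : ℝ, 0 < t →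
      ∀ T : H ≃ᵐ H, IsGaussianTransformation μ (A.dilate t) T →
        (ENNReal.ofReal t < tdiss → IsConservative μ T) ∧
        (tdiss < ENNReal.ofReal t → IsTotallyDissipative μ T) := by
  -- If no parameter gives convergence, the infimum over the empty set is ∞. Below the infimum the
  -- zero-one law upgrades failure of a.e. convergence to a.e. divergence.
  refine ⟨sInf {c | ∃ t : ℝ, 0 < t ∧ c = ENNReal.ofReal t ∧
    ∀ᵐ x ∂μ, x ∈ summableSet μ (A.dilate t).orbit}, fun t ht T hT => ⟨fun hlt => ?_, fun hlt => ?_⟩⟩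
  · refine isConservative_of_tsum_eq_top (fun n => measurable_expDensity _) hT.map_zpow ?_
    rcases measure_summableSet_orbit hμ (A.dilate t) hV with h | h
    · have h1 : ∀ᵐ x ∂μ, x ∉ summableSet μ (A.dilate t).orbit := measure_eq_zero_iff_ae_notMem.mp h
      filter_upwards [h1] with x hx
      simpa [summableSet] using hx
    · refine absurd hlt (not_lt.mpr (sInf_le ⟨t, ht, rfl, ?_⟩))
      exact (prob_compl_eq_zero_iff (measurableSet_summableSet _)).mpr h
  · obtain ⟨_, ⟨s, hs, rfl, hsum⟩, hst⟩ := sInf_lt_iff.mp hlt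
    refine isTotallyDissipative_of_tsum_ne_top (fun n => measurable_expDensity _)
      (fun n x => expDensity_ne_zero _ x) (fun n x => expDensity_ne_top _ x) hT.map_zpow ?_
    have h1 : (A.dilate s).orbit = fun n => s • A.orbit n := funext fun n => A.orbit_dilate s n
    have h2 : (A.dilate t).orbit = fun n => t • A.orbit n := funext fun n => A.orbit_dilate t n
    rw [h1] at hsum
    rw [h2]
    exact ae_mem_summableSet_of_lt hμ hs ((ENNReal.ofReal_lt_ofReal_iff ht).mp hst) hsum

/-! ### Existence -/

/-- Two measurable maps that are inverse to each other almost everywhere come from an everywhere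
invertible transformation. -/
theorem exists_measurableEquiv_of_ae_inverse {X : Type*} [MeasurableSpace X] {μ : Measure X}
    {e e' : X → X} (he : Measure.QuasiMeasurePreserving e μ μ)
    (he' : Measure.QuasiMeasurePreserving e' μ μ) (h : ∀ᵐ x ∂μ, e' (e x) = x)
    (h' : ∀ᵐ x ∂μ, e (e' x) = x) : ∃ T : X ≃ᵐ X, T =ᵐ[μ] e ∧ T.symm =ᵐ[μ] e' := by
  classical
  let C : Set X := (toMeasurable μ {x | e' (e x) = x ∧ e (e' x) = x}ᶜ)ᶜ
  have hCm : MeasurableSet C := (measurableSet_toMeasurable _ _).compl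
  have hC : ∀ᵐ x ∂μ, x ∈ C := by
    rw [ae_iff]
    simp only [C, Set.mem_compl_iff, not_not, Set.ofPred_mem_eq, measure_toMeasurable]
    exact ae_iff.mp (h.and h')
  have hC1 : ∀ x ∈ C, e' (e x) = x ∧ e (e' x) = x := by
    intro x hx
    by_contra hne
    exact hx (subset_toMeasurable _ _ hne)
  -- Conull and stable under both maps, which are mutually inverse on it; the equivalence is the
  -- identity off G.
  let G : Set X := {x | ∀ n : ℕ, e^[n] x ∈ C ∧ e'^[n] x ∈ C}
  have hGm : MeasurableSet G := by
    have : G = ⋂ n : ℕ, (e^[n] ⁻¹' C ∩ e'^[n] ⁻¹' C) := by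
      ext x
      simp [G]
    rw [this]
    exact MeasurableSet.iInter fun n =>
      (he.measurable.iterate n hCm).inter (he'.measurable.iterate n hCm)
  have hG : ∀ᵐ x ∂μ, x ∈ G :=
    ae_all_iff.mpr fun n => ((he.iterate n).ae hC).and ((he'.iterate n).ae hC)
  have hGC : ∀ x ∈ G, x ∈ C := fun x hx => (hx 0).1
  have hGe : ∀ x ∈ G, e x ∈ G := by
    intro x hx n
    refine ⟨(hx (n + 1)).1, ?_⟩
    cases n with
    | zero => exact (hx 1).1
    | succ n =>
      rw [Function.iterate_succ_apply, (hC1 x (hGC x hx)).1]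
      exact (hx n).2
  have hGe' : ∀ x ∈ G, e' x ∈ G := by
    intro x hx n
    refine ⟨?_, (hx (n + 1)).2⟩
    cases n with
    | zero => exact (hx 1).2
    | succ n =>
      rw [Function.iterate_succ_apply, (hC1 x (hGC x hx)).2]
      exact (hx n).1
  refine ⟨⟨⟨G.piecewise e id, G.piecewise e' id, fun x => ?_, fun x => ?_⟩,
    he.measurable.piecewise hGm measurable_id, he'.measurable.piecewise hGm measurable_id⟩, ?_, ?_⟩
  · by_cases hx : x ∈ G
    · simp [hx, hGe x hx, (hC1 x (hGC x hx)).1]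
    · simp [hx]
  · by_cases hx : x ∈ G
    · simp [hx, hGe' x hx, (hC1 x (hGC x hx)).2]
    · simp [hx]
  · filter_upwards [hG] with x hx
    exact Set.piecewise_eq_of_mem _ _ _ hx
  · filter_upwards [hG] with x hx
    exact Set.piecewise_eq_of_mem _ _ _ hx

/-! ### Extension of orthogonal operators of H₀ to measure-preserving maps of H -/

theorem lintegral_enorm_ell_sq_congr (hμ : IsCenteredGaussian μ B) {u w : CameronMartin hS}
    (huw : ‖u‖ = ‖w‖) : ∫⁻ x, ‖ell μ hS u x‖ₑ ^ 2 ∂μ = ∫⁻ x, ‖ell μ hS w x‖ₑ ^ 2 ∂μ := by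
  have h : ∀ v : CameronMartin hS, ∫⁻ x, ‖ell μ hS v x‖ₑ ^ 2 ∂μ
      = ∫⁻ y, ‖y‖ₑ ^ 2 ∂(gaussianReal 0 (‖v‖₊ ^ 2)) := fun v => by
    rw [← map_ell hμ v, lintegral_map (by fun_prop) (measurable_ell v)]
  rw [h, h, show ‖u‖₊ = ‖w‖₊ from NNReal.eq huw]

/-- Orthonormal vectors are √2 apart, so balls of radius 1/2 around them are disjoint open sets in a
separable space. -/
theorem countable_of_orthonormal {ι : Type*} {e : ι → H} (he : Orthonormal ℝ e) :
    Countable ι := by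
  refine Pairwise.countable_of_isOpen_disjoint (s := fun i => Metric.ball (e i) (1 / 2))
    (fun i j hij => Metric.ball_disjoint_ball ?_) (fun i => Metric.isOpen_ball)
    (fun i => ⟨e i, Metric.mem_ball_self (by norm_num)⟩)
  have h1 : ‖e i - e j‖ ^ 2 = 2 := by
    rw [norm_sub_sq_real, he.1, he.1, he.2 hij]
    norm_num
  rw [dist_eq_norm]
  nlinarith [norm_nonneg (e i - e j)]

theorem tsum_enorm_inner_sq_le {ι : Type*} {e : ι → H} (he : Orthonormal ℝ e) (x : H) :
    ∑' i, ‖⟪e i, x⟫‖ₑ ^ 2 ≤ ‖x‖ₑ ^ 2 := by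
  have h1 : ∀ r : ℝ, ‖r‖ₑ ^ 2 = ENNReal.ofReal (‖r‖ ^ 2) := fun r => by
    rw [ENNReal.ofReal_pow (norm_nonneg _), ofReal_norm]
  have h2 : ‖x‖ₑ ^ 2 = ENNReal.ofReal (‖x‖ ^ 2) := by
    rw [ENNReal.ofReal_pow (norm_nonneg _), ofReal_norm]
  simp_rw [h1, h2]
  rw [← ENNReal.ofReal_tsum_of_nonneg (fun i => by positivity) (he.inner_products_summable x)]
  exact ENNReal.ofReal_le_ofReal (he.tsum_inner_products_le x)

/-- As V is isometric, each term has the second moment of ⟪e i, ·⟫; by Bessel these sum to at most ∫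
‖x‖² dμ, finite for a Gaussian measure. -/
theorem ae_summable_sq_ell (hμ : IsCenteredGaussian μ B)
    (V : CameronMartin hS ≃ₗᵢ[ℝ] CameronMartin hS)
    {ι : Type*} [Countable ι] {e : ι → H} (he : Orthonormal ℝ e) :
    ∀ᵐ x ∂μ, Summable fun i => ‖ell μ hS (V (covToCM hS (e i))) x‖ ^ 2 := by
  have hfin : ∫⁻ x, ∑' i, ‖ell μ hS (V (covToCM hS (e i))) x‖ₑ ^ 2 ∂μ ≠ ∞ := by
    rw [lintegral_tsum fun i => ((measurable_ell _).enorm.pow_const 2).aemeasurable]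
    have h1 : ∀ i, ∫⁻ x, ‖ell μ hS (V (covToCM hS (e i))) x‖ₑ ^ 2 ∂μ
        = ∫⁻ x, ‖⟪e i, x⟫‖ₑ ^ 2 ∂μ := fun i => by
      rw [lintegral_enorm_ell_sq_congr hμ (V.norm_map _)]
      refine lintegral_congr_ae ?_
      filter_upwards [hμ.ell_covToCM hS (e i)] with x hx
      rw [hx]
    simp_rw [h1]
    rw [← lintegral_tsum fun i => (by fun_prop)]
    refine ((lintegral_mono fun x => tsum_enorm_inner_sq_le he x).trans_lt ?_).ne
    have h2 := (hμ.memLp_id hS).2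
    rw [eLpNorm_lt_top_iff_lintegral_rpow_enorm_lt_top (by norm_num) (by norm_num)] at h2
    simpa using h2
  have hm : Measurable fun x => ∑' i, ‖ell μ hS (V (covToCM hS (e i))) x‖ₑ ^ 2 :=
    Measurable.tsum fun i => (measurable_ell _).enorm.pow_const 2
  filter_upwards [ae_lt_top hm hfin] with x hx
  have h3 := ENNReal.summable_toReal hx.ne
  simpa using h3

/-- R is a measurable version of the a.e. convergent series Σ l_{V B b_i}(x) b_i. -/
theorem exists_inner_basis_eq_ell (hμ : IsCenteredGaussian μ B)
    (V : CameronMartin hS ≃ₗᵢ[ℝ] CameronMartin hS) {ι : Type*} [Countable ι]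
    (b : HilbertBasis ι ℝ H) :
    ∃ R : H → H, Measurable R ∧
      ∀ᵐ x ∂μ, ∀ i, ⟪b i, R x⟫ = ell μ hS (V (covToCM hS (b i))) x := by
  have : SecondCountableTopology H := UniformSpace.secondCountable_of_separable H
  let a : ι → H → ℝ := fun i => ell μ hS (V (covToCM hS (b i)))
  have ham : ∀ i, Measurable (a i) := fun i => measurable_ell _
  have hkey : ∀ᵐ x ∂μ, HasSum (fun i => a i x • b i) (∑' i, a i x • b i) ∧
      ∀ i, ⟪b i, ∑' i, a i x • b i⟫ = a i x := by
    filter_upwards [ae_summable_sq_ell hμ V b.orthonormal] with x hx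
    have hmem : Memℓp (fun i => a i x) 2 := by
      rw [memℓp_gen_iff (by norm_num)]
      simpa [a] using hx
    have h1 := b.hasSum_repr_symm ⟨_, hmem⟩
    have h2 : HasSum (fun i => a i x • b i) (b.repr.symm ⟨_, hmem⟩) := h1
    rw [h2.tsum_eq]
    refine ⟨h2, fun i => ?_⟩
    rw [← b.repr_apply_apply, LinearIsometryEquiv.apply_symm_apply]
  have hR : AEMeasurable (fun x => ∑' i, a i x • b i) μ := by
    refine aemeasurable_of_tendsto_metrizable_ae (atTop : Filter (Finset ι))
      (f := fun s x => ∑ i ∈ s, a i x • b i)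
      (fun s => (Finset.measurable_fun_sum s fun i _ => (ham i).smul_const _).aemeasurable) ?_
    filter_upwards [hkey] with x hx
    exact hx.1
  refine ⟨hR.mk _, hR.measurable_mk, ?_⟩
  filter_upwards [hR.ae_eq_mk, hkey] with x h1 h2 i
  rw [← h1]
  exact h2.2 i

theorem continuous_covToCM : Continuous (covToCM hS) := by
  have h : (covToCM hS : H → CameronMartin hS) = sqrtIsometry hS ∘ S := rfl
  rw [h]
  exact (sqrtIsometry hS).continuous.comp S.continuous

theorem exists_inner_eq_ell (hμ : IsCenteredGaussian μ B)
    (V : CameronMartin hS ≃ₗᵢ[ℝ] CameronMartin hS) :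
    ∃ R : H → H, Measurable R ∧ ∀ y, ∀ᵐ x ∂μ, ⟪y, R x⟫ = ell μ hS (V (covToCM hS y)) x := by
  obtain ⟨w, b, -⟩ := exists_hilbertBasis ℝ H
  have : Countable w := countable_of_orthonormal b.orthonormal
  obtain ⟨R, hRm, hR⟩ := exists_inner_basis_eq_ell hμ V b
  refine ⟨R, hRm, fun y => ?_⟩
  have hspan : ∀ v ∈ Submodule.span ℝ (Set.range b),
      ∀ᵐ x ∂μ, ⟪v, R x⟫ = ell μ hS (V (covToCM hS v)) x := by
    intro v hv
    induction hv using Submodule.span_induction with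
    | mem v hv =>
      obtain ⟨i, rfl⟩ := hv
      filter_upwards [hR] with x hx
      exact hx i
    | zero => simp
    | add v v' _ _ h h' =>
      rw [map_add, map_add]
      filter_upwards [h, h', ell_add (μ := μ) (V (covToCM hS v)) (V (covToCM hS v'))]
        with x h1 h2 h3
      rw [h3, inner_add_left, h1, h2]
    | smul c v _ h =>
      rw [map_smul, map_smul]
      filter_upwards [h, ell_smul (μ := μ) c (V (covToCM hS v))] with x h1 h2
      rw [h2, real_inner_smul_left, h1]
  have hdense : Dense (Submodule.span ℝ (Set.range b) : Set H) :=
    Submodule.dense_iff_topologicalClosure_eq_top.mpr b.dense_span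
  obtain ⟨v, hv, hlim⟩ := mem_closure_iff_seq_limit.mp (hdense y)
  obtain ⟨ns, hns, hae⟩ := exists_subseq_ell_tendsto (μ := μ)
    (((V.continuous.comp continuous_covToCM).tendsto y).comp hlim)
  filter_upwards [hae, ae_all_iff.mpr fun n => hspan _ (hv n)] with x h1 h2
  have h3 : Tendsto (fun n => ⟪v (ns n), R x⟫) atTop (𝓝 ⟪y, R x⟫) :=
    (hlim.comp hns.tendsto_atTop).inner tendsto_const_nhds
  refine tendsto_nhds_unique h3 (h1.congr fun n => ?_)
  rw [h2]
  rfl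

/-- An orthogonal operator `V` of `H₀` extends to a measure-preserving map of `H`. -/
theorem exists_measurePreserving_ell_comp (hμ : IsCenteredGaussian μ B)
    (V : CameronMartin hS ≃ₗᵢ[ℝ] CameronMartin hS) :
    ∃ R : H → H, MeasurePreserving R μ μ ∧
      ∀ u, ∀ᵐ x ∂μ, ell μ hS u (R x) = ell μ hS (V u) x := by
  have : SecondCountableTopology H := UniformSpace.secondCountable_of_separable H
  obtain ⟨R, hRm, hR⟩ := exists_inner_eq_ell hμ V
  have hmp : MeasurePreserving R μ μ := by
    refine ⟨hRm, ?_⟩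
    have := Measure.isProbabilityMeasure_map (μ := μ) hRm.aemeasurable
    apply Measure.ext_of_charFun
    ext y
    rw [charFun_apply, integral_map hRm.aemeasurable (Measurable.aestronglyMeasurable (by fun_prop)),
      hμ y, ← norm_sq_covToCM hS, ← V.norm_map, ← integral_cexp_ell hμ]
    refine integral_congr_ae ?_
    filter_upwards [hR y] with x hx
    rw [← hx, real_inner_comm]
  refine ⟨R, hmp, fun u => ?_⟩
  obtain ⟨v, hv⟩ := exists_seq_covToCM_tendsto u
  obtain ⟨ns, hns, h1⟩ := exists_subseq_ell_tendsto (μ := μ) hv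
  -- A further subsequence, so that the functions at R x and those for V u converge together.
  obtain ⟨ms, hms, h2⟩ := exists_subseq_ell_tendsto (μ := μ)
    (((V.continuous.tendsto u).comp hv).comp hns.tendsto_atTop)
  have hall : ∀ᵐ x ∂μ, ∀ n, ell μ hS (covToCM hS (v n)) x = ⟪v n, x⟫ :=
    ae_all_iff.mpr fun n => hμ.ell_covToCM hS (v n)
  filter_upwards [hmp.quasiMeasurePreserving.ae h1, h2, hmp.quasiMeasurePreserving.ae hall,
    ae_all_iff.mpr fun n => hR (v n)] with x h3 h4 h5 h6
  refine tendsto_nhds_unique (h3.comp hms.tendsto_atTop) (h4.congr fun n => ?_)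
  simp only [Function.comp_apply]
  rw [h5, h6]

/-- Both sides have the same inner product with each fixed y, a.e. in x; countably many dense y give
one common null set. -/
theorem ae_leftInverse_of_ell_comp (hμ : IsCenteredGaussian μ B)
    {V : CameronMartin hS ≃ₗᵢ[ℝ] CameronMartin hS} {R R' : H → H} (hR : MeasurePreserving R μ μ)
    (hR' : MeasurePreserving R' μ μ) (hell : ∀ u, ∀ᵐ x ∂μ, ell μ hS u (R x) = ell μ hS (V u) x)
    (hell' : ∀ u, ∀ᵐ x ∂μ, ell μ hS u (R' x) = ell μ hS (V.symm u) x) :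
    ∀ᵐ x ∂μ, R' (R x) = x := by
  have h : ∀ y, ∀ᵐ x ∂μ, ⟪y, R' (R x)⟫ = ⟪y, x⟫ := by
    intro y
    have hy := hμ.ell_covToCM hS y
    filter_upwards [hy, hR.quasiMeasurePreserving.ae (hR'.quasiMeasurePreserving.ae hy),
      hell (V.symm (covToCM hS y)), hR.quasiMeasurePreserving.ae (hell' (covToCM hS y))]
      with x h1 h2 h3 h4
    rw [← h2, h4, h3, V.apply_symm_apply, h1]
  have hall := ae_all_iff.mpr fun n => h (TopologicalSpace.denseSeq H n)
  filter_upwards [hall] with x hx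
  refine ext_inner_left ℝ fun y => ?_
  exact congrFun (Continuous.ext_on (TopologicalSpace.denseRange_denseSeq H)
    (f := fun y => ⟪y, R' (R x)⟫) (g := fun y => ⟪y, x⟫) (by fun_prop) (by fun_prop)
    (by rintro _ ⟨n, rfl⟩; exact hx n)) y

theorem exists_isGaussianTransformation (hμ : IsCenteredGaussian μ B)
    (A : Aff (CameronMartin hS)) : ∃ T : H ≃ᵐ H, IsGaussianTransformation μ A T := by
  obtain ⟨R, hR, hell⟩ := exists_measurePreserving_ell_comp hμ A.V
  obtain ⟨R', hR', hell'⟩ := exists_measurePreserving_ell_comp hμ A.V.symm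
  have hRR' := ae_leftInverse_of_ell_comp hμ hR hR' hell hell'
  have hR'R := ae_leftInverse_of_ell_comp hμ hR' hR hell' (by simpa using hell)
  have hqf := quasiMeasurePreserving_add_incl hμ A.f
  have hqf' := quasiMeasurePreserving_add_incl hμ (-A.f)
  -- The Koopman operator composes with T⁻¹, so T⁻¹ must contain R, for which l_h ∘ R = l_{V h};
  -- hence T uses R', the extension of V⁻¹.
  let e : H → H := fun x => R' x + incl hS A.f
  let e' : H → H := fun x => R (x + incl hS (-A.f))
  have he : Measure.QuasiMeasurePreserving e μ μ := hqf.comp hR'.quasiMeasurePreserving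
  have he' : Measure.QuasiMeasurePreserving e' μ μ := hR.quasiMeasurePreserving.comp hqf'
  have hinv : ∀ᵐ x ∂μ, e' (e x) = x := by
    filter_upwards [hR'R] with x hx
    simpa [e, e'] using hx
  have hinv' : ∀ᵐ x ∂μ, e (e' x) = x := by
    filter_upwards [hqf'.ae hRR'] with x hx
    simp only [e, e']
    rw [hx]
    simp
  obtain ⟨T, hT, hTs⟩ := exists_measurableEquiv_of_ae_inverse he he' hinv hinv'
  have hmap : μ.map T = μ.withDensity (expDensity μ A.f) := by
    rw [Measure.map_congr hT, ← map_add_incl hμ]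
    have h1 : e = (fun x => x + incl hS A.f) ∘ R' := rfl
    rw [h1, ← Measure.map_map (by fun_prop) hR'.measurable, hR'.map_eq]
  refine ⟨T, ⟨T.measurable, ?_⟩, ⟨T.symm.measurable, ?_⟩, fun h => ?_⟩
  · rw [hmap]
    exact withDensity_absolutelyContinuous _ _
  · rw [Measure.map_congr hTs]
    exact he'.absolutelyContinuous
  · have hrn := Measure.rnDeriv_withDensity μ (measurable_expDensity (μ := μ) A.f)
    rw [← hmap] at hrn
    filter_upwards [weylExp_dilate_half (μ := μ) A h, hrn, hTs, hqf'.ae (hell h),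
      ell_add_incl hμ (A.V h) (-A.f)] with x h1 h2 h3 h4 h5
    rw [h1, koopman, h2, h3, expDensity, ENNReal.toReal_ofReal (expVec_pos _ _).le]
    simp only [e']
    rw [expVec, h4, h5, inner_neg_right, real_inner_comm A.f, sub_eq_add_neg _ ⟪A.f, A.V h⟫]

end NonsingularGaussian

end

theorem proposition3p13
    {H : Type*} [NormedAddCommGroup H] [InnerProductSpace ℝ H] [CompleteSpace H]
    [TopologicalSpace.SeparableSpace H] [MeasurableSpace H] [BorelSpace H]
    (hdim : ¬ FiniteDimensional ℝ H)
    (B S : H →L[ℝ] H) (hS : NonsingularGaussian.IsSqrtOf S B)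
    (μ : Measure H) [IsProbabilityMeasure μ]
    (hμ : NonsingularGaussian.IsCenteredGaussian μ B)
    (A : NonsingularGaussian.Aff (NonsingularGaussian.CameronMartin hS))
    (hV : ∀ h : NonsingularGaussian.CameronMartin hS, A.V h = h → h = 0) :
    ∃ tdiss : ℝ≥0∞, ∀ t : ℝ, 0 < t →
      (∃ T : H ≃ᵐ H, NonsingularGaussian.IsGaussianTransformation μ (A.dilate t) T) ∧
      ∀ T : H ≃ᵐ H, NonsingularGaussian.IsGaussianTransformation μ (A.dilate t) T →
        (ENNReal.ofReal t < tdiss → NonsingularGaussian.IsConservative μ T) ∧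
        (tdiss < ENNReal.ofReal t → NonsingularGaussian.IsTotallyDissipative μ T) := by
  obtain ⟨tdiss, h⟩ := NonsingularGaussian.exists_tdiss hμ A hV
  exact ⟨tdiss, fun t ht =>
    ⟨NonsingularGaussian.exists_isGaussianTransformation hμ (A.dilate t), h t ht⟩⟩
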